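/- Let $m\ge 1$, let $(\mathbb P,\sigma)$ be a connected $m$-dimensional smooth Riemannian manifold, let $I\subseteq\mathbb R$ be an open interval, and let $h\in C^\infty(\mathbb P)$ and $\rho\in C^\infty(I)$ be positive functions. Let $\overline M=I\,{}_h\!\times_\rho\mathbb P$ be the doubly warped product spacetime, that is, the manifold $I\times\mathbb P$ with the Lorentzian metric $$\overline g_{(t,x)}=-h(x)^2\,\pi_I^*(dt^2)+\rho(t)^2\,\pi_{\mathbb P}^*(\sigma),$$ where $\pi_I$ and $\pi_{\mathbb P}$ are the projections onto the factors, time-oriented by $\partial_t$. Suppose that $\rho'\ge 0$ on $I$. Let $M$ be a connected compact smooth $m$-dimensional manifold (without boundary), and let $\psi:M\to\overline M$ be a spacelike hypersurface, that is, a smooth map for which $g=\psi^*\overline g$ is a Riemannian metric on $M$. Let $N$ be its future-pointing unit normal, i.e. $N$ is orthogonal to $d\psi(TM)$, $\overline g(N,N)=-1$ and $\overline g(N,\partial_t)<0$. Let $\mathrm{I\!I}(V,W)=\overline\nabla_VW-\nabla_VW$ be the second fundamental form, with $\overline\nabla$ and $\nabla$ the Levi-Civita connections of $\overline g$ and $g$,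 let $\mathbf H=\frac1m\operatorname{trace}_g\mathrm{I\!I}$ be the mean curvature vector, and let $H=-\overline g(\mathbf H,N)$ be the mean curvature in the direction of $N$. If $$H\ \ge\ \frac{\rho'}{h\rho}\circ\psi\qquad\text{on }M$$ (where $\rho,\rho'$ are evaluated at $\pi_I\circ\psi$ and $h$ at $\pi_{\mathbb P}\circ\psi$), then $\psi(M)$ is a spacelike slice: there is $t_0\in I$ with $\psi(M)=\{t_0\}\times\mathbb P$. -/

import Mathlib

open Bundle
open scoped Manifold ContDiff

noncomputable section

/-- Pullback `L^* B` of a bilinear form along a linear map: `(v, w) ↦ B (L v) (L w)`. -/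
def pullbackForm {V W : Type*} [NormedAddCommGroup V] [NormedSpace ℝ V]
    [NormedAddCommGroup W] [NormedSpace ℝ W]
    (B : W →L[ℝ] W →L[ℝ] ℝ) (L : V →L[ℝ] W) : V →L[ℝ] V →L[ℝ] ℝ :=
  B.bilinearComp L L

section Coordinates

variable {V : Type*} [NormedAddCommGroup V] [NormedSpace ℝ V]

/-- The Koszul expression (Christoffel symbols of the first kind) of a semi-Riemannian metric `G`
on an open subset of a vector space: the linear form
`z ↦ (∂_v G (w, z) + ∂_w G (v, z) - ∂_z G (v, w)) / 2` at the point `y`. -/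
def koszulForm (G : V → V →L[ℝ] V →L[ℝ] ℝ) (y v w : V) : V →L[ℝ] ℝ :=
  (2⁻¹ : ℝ) • (fderiv ℝ G y v w + fderiv ℝ G y w v - ((fderiv ℝ G y).flip v).flip w)

/-- The Christoffel symbols (of the second kind) of the Levi-Civita connection of a semi-Riemannian
metric `G` on an open subset of a vector space: `Γ_y (v, w)` is the vector `∇_v w` for the
constant fields `v`, `w`, determined by `G_y (Γ_y (v, w), z) = koszulForm G y v w z`. -/
def christoffel (G : V → V →L[ℝ] V →L[ℝ] ℝ) (y v w : V) : V :=
  (G y).inverse (koszulForm G y v w)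

end Coordinates

section Manifolds

variable {E : Type*} [NormedAddCommGroup E] [NormedSpace ℝ E] {H : Type*} [TopologicalSpace H]
  (J : ModelWithCorners ℝ E H) {N : Type*} [TopologicalSpace N] [ChartedSpace H N]

/-- The expression of a field `B` of bilinear forms on the tangent spaces of a manifold in the
preferred chart around `p`, that is, its pullback by the inverse of the chart: at the coordinates
`y` of a point it is the bilinear form `(v, w) ↦ B (d(chart⁻¹)_y v, d(chart⁻¹)_y w)`. -/
def coordForm (B : ∀ q : N, TangentSpace J q →L[ℝ] TangentSpace J q →L[ℝ] ℝ) (p : N) :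
    E → E →L[ℝ] E →L[ℝ] ℝ :=
  fun y => pullbackForm (W := E) (B ((extChartAt J p).symm y))
    (mfderiv 𝓘(ℝ, E) J (extChartAt J p).symm y)

end Manifolds

/-- The model with corners of the product `ℝ × P` with `P` an `m`-dimensional manifold. -/
abbrev stModel (m : ℕ) : ModelWithCorners ℝ (ℝ × EuclideanSpace ℝ (Fin m))
    (ModelProd ℝ (EuclideanSpace ℝ (Fin m))) :=
  (𝓘(ℝ, ℝ)).prod (𝓡 m)

/-- The data `(I, ρ, (P, σ), h)` of a doubly warped product spacetime `I _h×_ρ P`: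
an open interval `I`, a positive smooth function `ρ` on `I`, a Riemannian metric `σ` and a positive
smooth function `h` on the `m`-dimensional manifold `P`. The underlying manifold of the spacetime is
the open subset `I × P` of `ℝ × P`; the values of `ρ` outside `I` are irrelevant. -/
structure DoublyWarpedProduct (m : ℕ) (P : Type*) [TopologicalSpace P]
    [ChartedSpace (EuclideanSpace ℝ (Fin m)) P] [IsManifold (𝓡 m) ∞ P] where
  /-- the open interval of time coordinates -/
  I : Set ℝ
  isOpen_I : IsOpen I
  ordConnected_I : I.OrdConnected
  /-- the warping function on the interval -/
  ρ : ℝ → ℝ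
  contDiffOn_ρ : ContDiffOn ℝ ∞ ρ I
  ρ_pos : ∀ t ∈ I, 0 < ρ t
  /-- the Riemannian metric of the fibre -/
  σ : ContMDiffRiemannianMetric (𝓡 m) ∞ (EuclideanSpace ℝ (Fin m))
    (fun x : P => TangentSpace (𝓡 m) x)
  /-- the warping function on the fibre -/
  h : P → ℝ
  contMDiff_h : ContMDiff (𝓡 m) 𝓘(ℝ, ℝ) ∞ h
  h_pos : ∀ x, 0 < h x

namespace DoublyWarpedProduct

variable {m : ℕ} {P : Type*} [TopologicalSpace P]
  [ChartedSpace (EuclideanSpace ℝ (Fin m)) P] [IsManifold (𝓡 m) ∞ P]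
  (D : DoublyWarpedProduct m P)

/-- The Lorentzian metric `-h² π_I^*(dt²) + ρ² π_P^*(σ)`. -/
def metric (p : ℝ × P) :
    TangentSpace (stModel m) p →L[ℝ] TangentSpace (stModel m) p →L[ℝ] ℝ :=
  -(D.h p.2 ^ 2) • pullbackForm (V := ℝ × EuclideanSpace ℝ (Fin m)) (W := ℝ)
      (ContinuousLinearMap.mul ℝ ℝ) (mfderiv (stModel m) 𝓘(ℝ, ℝ) Prod.fst p)
    + (D.ρ p.1 ^ 2) • pullbackForm (V := ℝ × EuclideanSpace ℝ (Fin m))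
      (W := EuclideanSpace ℝ (Fin m)) (D.σ.inner p.2) (mfderiv (stModel m) (𝓡 m) Prod.snd p)

/-- The coordinate vector field `∂_t`, which gives the time orientation. -/
def dt (p : ℝ × P) : TangentSpace (stModel m) p :=
  mfderiv 𝓘(ℝ, ℝ) (stModel m) (fun t : ℝ => (t, p.2)) p.1 (1 : ℝ)

/-- The mean curvature `ρ' / (h ρ)` of the slices. -/
def sliceMeanCurvature (p : ℝ × P) : ℝ :=
  deriv D.ρ p.1 / (D.h p.2 * D.ρ p.1)

section Hypersurfaces

variable {M : Type*} [TopologicalSpace M] [ChartedSpace (EuclideanSpace ℝ (Fin m)) M]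
  (ψ : M → ℝ × P)

/-- The induced metric `g = ψ^* ḡ`. -/
def inducedMetric (q : M) : TangentSpace (𝓡 m) q →L[ℝ] TangentSpace (𝓡 m) q →L[ℝ] ℝ :=
  pullbackForm (V := EuclideanSpace ℝ (Fin m)) (W := ℝ × EuclideanSpace ℝ (Fin m))
    (D.metric (ψ q)) (mfderiv (𝓡 m) (stModel m) ψ q)

/-- `ψ : M → I × P` is a (smooth, immersed) spacelike hypersurface, where `dim M = dim P`: the
induced form `g = ψ^* ḡ` is positive definite at every point. In particular `ψ` is an
immersion. -/
structure IsSpacelikeHypersurface : Prop where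
  contMDiff : ContMDiff (𝓡 m) (stModel m) ∞ ψ
  mem_I : ∀ q, (ψ q).1 ∈ D.I
  spacelike : ∀ (q : M) (v : TangentSpace (𝓡 m) q), v ≠ 0 → 0 < D.inducedMetric ψ q v v

/-- `ν` is the future-pointing unit normal vector of `ψ` at `q`: it is orthogonal to the image of
`dψ_q`, satisfies `ḡ(ν, ν) = -1` and has the time orientation of `∂_t`. -/
structure IsFutureUnitNormal (q : M) (ν : TangentSpace (stModel m) (ψ q)) : Prop where
  normal : ∀ v : TangentSpace (𝓡 m) q,
    D.metric (ψ q) ν (mfderiv (𝓡 m) (stModel m) ψ q v) = 0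
  unit : D.metric (ψ q) ν ν = -1
  future : D.metric (ψ q) ν (dt (ψ q)) < 0

/-- The second fundamental form `II(v, w) = ∇̄_v w - ∇_v w` of `ψ` at `q`, with `∇̄`, `∇` the
Levi-Civita connections of `ḡ` and of the induced metric `g`. In the preferred charts around `q` and
`ψ q` (which are the ones that identify the tangent spaces at these two points with the model
spaces) and with `F` the expression of `ψ`, extending `v`, `w` with constant coefficients gives
`∇̄_v w = D²F(v, w) + Γ̄(DF v, DF w)` and `∇_v w = Γ(v, w)`. -/
def secondFundamentalForm (q : M) (v w : TangentSpace (𝓡 m) q) :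
    TangentSpace (stModel m) (ψ q) :=
  let F : EuclideanSpace ℝ (Fin m) → ℝ × EuclideanSpace ℝ (Fin m) :=
    writtenInExtChartAt (𝓡 m) (stModel m) q ψ
  let x : EuclideanSpace ℝ (Fin m) := extChartAt (𝓡 m) q q
  let y : ℝ × EuclideanSpace ℝ (Fin m) := extChartAt (stModel m) (ψ q) (ψ q)
  (fderiv ℝ (fderiv ℝ F) x v w
      + christoffel (coordForm (stModel m) D.metric (ψ q)) y (fderiv ℝ F x v) (fderiv ℝ F x w))
    - fderiv ℝ F x (christoffel (coordForm (𝓡 m) (D.inducedMetric ψ) q) x v w)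

/-- The coordinate basis of the tangent space of `M` at `q` in the preferred chart. -/
def coordBasis (q : M) (i : Fin m) : TangentSpace (𝓡 m) q :=
  (EuclideanSpace.single i (1 : ℝ) : EuclideanSpace ℝ (Fin m))

/-- The matrix `g_{ij}` of the induced metric at `q` in the coordinate basis. -/
def gram (q : M) : Matrix (Fin m) (Fin m) ℝ :=
  Matrix.of fun i j => D.inducedMetric ψ q (coordBasis q i) (coordBasis q j)

/-- The mean curvature vector `(1/m) trace_g II = (1/m) ∑_{i,j} g^{ij} II_{ij}`. -/
def meanCurvatureVector (q : M) : TangentSpace (stModel m) (ψ q) :=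
  (m : ℝ)⁻¹ • ∑ i, ∑ j,
    (D.gram ψ q)⁻¹ i j • D.secondFundamentalForm ψ q (coordBasis q i) (coordBasis q j)

/-- The mean curvature function at `q` in the direction of the unit timelike normal vector `ν`,
`H = -ḡ(𝐇, ν)`, so that `𝐇 = H ν`. -/
def meanCurvature (q : M) (ν : TangentSpace (stModel m) (ψ q)) : ℝ :=
  -D.metric (ψ q) (D.meanCurvatureVector ψ q) ν

end Hypersurfaces

end DoublyWarpedProduct

end

/-!
The proof is a maximum principle for the time function `τ = π_I ∘ ψ`. In a chart of the fibre the
spacetime metric is the doubly warped metric `-η² dt² + ρ² S` on an open subset of `ℝ × ℝᵐ`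
(`DoublyWarpedProduct.coordForm_metric`). Only the time component of its Christoffel symbols is
needed (`christoffel_warpedForm_fst`). Let `f₁, …, fₘ` be an orthonormal frame for the induced
metric `g`. Since the second fundamental form is normal (`apply_sndFDeriv_add_christoffel`) and `N`
is the normalized projection of `∂_t` (`exists_warped_unit_normal`), taking the time component of
`∑ᵢ II(fᵢ, fᵢ)` gives

  `∑ᵢ Hess τ(fᵢ, fᵢ) + (ρ' / ρ) |∇τ|² + (2 / h) ⟨∇h, ∇τ⟩ = (m / h) (c H - ρ' / (h ρ))`,

where `h` is evaluated along `ψ` and `c = √(1 + h² |∇τ|²) ≥ 1`. The hypotheses `H ≥ ρ' / (h ρ)` and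
`ρ' ≥ 0` make the right hand side at least `(m ρ' / (h² ρ)) (c - 1) ≥ 0`
(`sum_hessian_time_nonneg`).

So `τ` is a subsolution of an elliptic equation without term of order zero. Near each point the
equation is uniformly elliptic with bounded coefficients, so the strong maximum principle
(`eventually_eq_of_isMax_of_elliptic`, proved with Hopf's exponential barrier) shows that the set
where `τ` attains its maximum is open; as `M` is compact and connected, `τ` is constant. Then `ψ`
followed by the projection to the fibre `P` is a local diffeomorphism, because `g` is positive
definite and `dτ = 0`. Its image is open, compact and nonempty in the connected manifold `P`,
hence all of `P`.

All differential geometry is done in coordinates. The curvature quantities at a point are defined in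
the preferred charts around it, whereas the maximum principle needs one chart on a whole
neighbourhood; the invariance of the Hessian under changes of coordinates (`hessian_comp`) connects
the two.
-/

set_option maxSynthPendingDepth 3

open Filter Topology Metric

/-! ### Second derivatives at a local maximum -/

section LocalMax

variable {V : Type*} [NormedAddCommGroup V] [NormedSpace ℝ V]

lemma deriv_deriv_nonpos_of_isLocalMax {f : ℝ → ℝ} {a : ℝ} (hf : ContinuousAt f a)
    (h : IsLocalMax f a) : deriv (deriv f) a ≤ 0 := by
  by_contra! hpos
  have hmin := isLocalMin_of_deriv_deriv_pos hpos h.deriv_eq_zero hf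
  have hconst : f =ᶠ[𝓝 a] fun _ => f a := by
    filter_upwards [h, hmin] with y h₁ h₂ using le_antisymm h₁ h₂
  have := hconst.deriv.deriv_eq
  simp at this
  exact hpos.ne' this

lemma fderiv_fderiv_nonpos_of_isLocalMax {u : V → ℝ} {p : V} (hu : ContDiffAt ℝ 2 u p)
    (h : IsLocalMax u p) (v : V) : fderiv ℝ (fderiv ℝ u) p v v ≤ 0 := by
  have hline : ∀ s : ℝ, HasDerivAt (fun s : ℝ => p + s • v) v s := fun s => by
    simpa using ((hasDerivAt_id s).smul_const v).const_add p
  have hcont : Tendsto (fun s : ℝ => p + s • v) (𝓝 0) (𝓝 p) := by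
    have := (hline 0).continuousAt.tendsto
    simpa using this
  have hd : ∀ᶠ s : ℝ in 𝓝 0, deriv (fun s : ℝ => u (p + s • v)) s
      = fderiv ℝ u (p + s • v) v := by
    have h1 : ∀ᶠ y in 𝓝 p, DifferentiableAt ℝ u y := by
      filter_upwards [hu.eventually (by simp)] with y hy using hy.differentiableAt (by simp)
    filter_upwards [hcont.eventually h1] with s hs
    exact (hs.hasFDerivAt.comp_hasDerivAt s (hline s)).deriv
  have h2 : DifferentiableAt ℝ (fderiv ℝ u) p :=
    (hu.fderiv_right (m := 1) (by norm_num)).differentiableAt (by simp)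
  have hdd : deriv (deriv fun s : ℝ => u (p + s • v)) 0 = fderiv ℝ (fderiv ℝ u) p v v := by
    have hd' : deriv (fun s : ℝ => u (p + s • v)) =ᶠ[𝓝 0] fun s => fderiv ℝ u (p + s • v) v := hd
    rw [hd'.deriv_eq]
    have h3 : HasFDerivAt (fderiv ℝ u) (fderiv ℝ (fderiv ℝ u) p) (p + (0 : ℝ) • v) := by
      simpa using h2.hasFDerivAt
    have h4 := h3.comp_hasDerivAt (0 : ℝ) (hline 0)
    exact ((ContinuousLinearMap.apply ℝ ℝ v).hasFDerivAt.comp_hasDerivAt (0 : ℝ) h4).deriv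
  rw [← hdd]
  refine deriv_deriv_nonpos_of_isLocalMax ?_ ?_
  · exact ContinuousAt.comp (g := u) (by simpa using hu.continuousAt) (hline 0).continuousAt
  · have := hcont.eventually h
    simpa [IsLocalMax, IsMaxFilter] using this

end LocalMax

/-! ### The strong maximum principle -/

section MaximumPrinciple

variable {V : Type*} [NormedAddCommGroup V] [InnerProductSpace ℝ V]

lemma hasFDerivAt_exp_neg_mul_norm_sub_sq (α : ℝ) (c y : V) :
    HasFDerivAt (fun y : V => Real.exp (-α * ‖y - c‖ ^ 2))
      ((-2 * α * Real.exp (-α * ‖y - c‖ ^ 2)) • innerSL ℝ (y - c)) y := by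
  have h1 : HasFDerivAt (fun y : V => ‖y - c‖ ^ 2) (2 • innerSL ℝ (y - c)) y := by
    simpa using (hasFDerivAt_id y).sub_const c |>.norm_sq
  convert (h1.const_mul (-α)).exp using 1
  ext v
  simp
  ring

lemma fderiv_fderiv_exp_neg_mul_norm_sub_sq (α : ℝ) (c y v : V) :
    fderiv ℝ (fderiv ℝ (fun y : V => Real.exp (-α * ‖y - c‖ ^ 2))) y v v
      = Real.exp (-α * ‖y - c‖ ^ 2) * (4 * α ^ 2 * inner ℝ (y - c) v ^ 2 - 2 * α * ‖v‖ ^ 2) := by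
  have h0 : fderiv ℝ (fun y : V => Real.exp (-α * ‖y - c‖ ^ 2)) =
      fun y => (-2 * α * Real.exp (-α * ‖y - c‖ ^ 2)) • innerSL ℝ (y - c) :=
    funext fun y => (hasFDerivAt_exp_neg_mul_norm_sub_sq α c y).fderiv
  let L : V →L[ℝ] V →L[ℝ] ℝ := innerSL ℝ
  have h1 : HasFDerivAt (fun y : V => innerSL ℝ (y - c)) L y := by
    have := (L.hasFDerivAt (x := y - c)).comp y ((hasFDerivAt_id y).sub_const c)
    rwa [ContinuousLinearMap.comp_id] at this
  have h2 : L v v = ‖v‖ ^ 2 := real_inner_self_eq_norm_sq v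
  rw [h0, (((hasFDerivAt_exp_neg_mul_norm_sub_sq α c y).const_mul (-2 * α)).fun_smul h1).fderiv]
  simp only [add_apply, smul_apply, ContinuousLinearMap.smulRight_apply, innerSL_apply_apply,
    smul_eq_mul, h2]
  ring

/-- Strong maximum principle, local form. The differential inequality says that
`∑ᵢ D²u(fᵢ, fᵢ) + C ‖Du‖ ≥ 0` for frames `f` (depending on the point) that are uniformly elliptic
and bounded, which is the case for the orthonormal frames of a metric. If `u` attains its maximum
over `U`, the set where it does so is open.

Otherwise some ball touches this set at exactly one boundary point `z`. Adding to `u` a small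
multiple of the barrier `exp(-α |y - c|²)`, with `c` the centre of the ball and `α` large, produces
an interior maximum near `z`, where the second derivatives contradict the differential
inequality. -/
theorem eventually_eq_of_isMax_of_elliptic [FiniteDimensional ℝ V] {ι : Type*} [Fintype ι]
    {U : Set V} (hU : IsOpen U) {u : V → ℝ} (hu : ∀ y ∈ U, ContDiffAt ℝ 2 u y)
    {lam Lam C : ℝ} (hlam : 0 < lam)
    (hL : ∀ y ∈ U, ∃ f : ι → V, (∀ z, lam * ‖z‖ ^ 2 ≤ ∑ i, inner ℝ z (f i) ^ 2) ∧
      (∑ i, ‖f i‖ ^ 2 ≤ Lam) ∧ 0 ≤ ∑ i, fderiv ℝ (fderiv ℝ u) y (f i) (f i) + C * ‖fderiv ℝ u y‖)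
    {K : ℝ} (hK : ∀ y ∈ U, u y ≤ K) {y₀ : V} (hy₀ : y₀ ∈ U) (huy₀ : u y₀ = K) :
    ∀ᶠ y in 𝓝 y₀, u y = K := by
  obtain ⟨r, hr, hrU⟩ := nhds_basis_closedBall.mem_iff.1 (hU.mem_nhds hy₀)
  by_contra hne
  have hcont : ContinuousOn u (closedBall y₀ r) := fun y hy =>
    (hu y (hrU hy)).continuousAt.continuousWithinAt
  obtain ⟨y₁, hy₁, huy₁⟩ : ∃ y₁ ∈ ball y₀ (r / 2), u y₁ ≠ K := by
    by_contra! h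
    exact hne (eventually_of_mem (ball_mem_nhds y₀ (half_pos hr)) h)
  rw [mem_ball] at hy₁
  -- `z` is a point of the level set closest to `y₁`
  have hZ : IsCompact (closedBall y₀ r ∩ u ⁻¹' {K}) :=
    (isCompact_closedBall y₀ r).of_isClosed_subset
      (hcont.preimage_isClosed_of_isClosed isClosed_closedBall isClosed_singleton)
      Set.inter_subset_left
  have hy₀Z : y₀ ∈ closedBall y₀ r ∩ u ⁻¹' {K} := ⟨mem_closedBall_self hr.le, huy₀⟩
  obtain ⟨z, ⟨hzr, hzK⟩, hz⟩ := hZ.exists_infDist_eq_dist ⟨y₀, hy₀Z⟩ y₁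
  have hzU : z ∈ U := hrU hzr
  have huz : u z = K := hzK
  have hzmin : ∀ y ∈ closedBall y₀ r, u y = K → dist y₁ z ≤ dist y₁ y := fun y hy hyK =>
    hz ▸ infDist_le_dist_of_mem ⟨hy, hyK⟩
  have hR : dist y₁ z < r / 2 := (hzmin y₀ hy₀Z.1 huy₀).trans_lt hy₁
  have hRpos : 0 < dist y₁ z := dist_pos.2 fun h => huy₁ (h ▸ huz)
  -- `c` is the centre of a ball touching the level set only at `z`
  set c : V := midpoint ℝ y₁ z with hc
  set a : V := z - c with ha
  have hca : c - y₁ = a := by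
    rw [ha, hc, midpoint_eq_smul_add, invOf_eq_inv]; module
  set s : ℝ := ‖a‖ with hs
  have hRs : dist y₁ z = 2 * s := by
    have : z - y₁ = (2 : ℝ) • a := by
      rw [two_smul]; nth_rewrite 2 [← hca]; rw [ha]; abel
    rw [dist_comm, dist_eq_norm, this, norm_smul]; simp [hs]
  have hspos : 0 < s := by linarith
  -- by the parallelogram law, points of the ball other than `z` are closer to `y₁` than `z`
  have htouch : ∀ y ∈ U, ‖y - c‖ ≤ s → y ≠ z → u y < K := by
    intro y hyU hyc hyz
    have h1 : ‖a + (y - c)‖ ^ 2 + ‖a - (y - c)‖ ^ 2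
        = 2 * (‖a‖ ^ 2 + ‖y - c‖ ^ 2) := parallelogram_law_with_norm ℝ _ _
    have h2 : a + (y - c) = y - y₁ := by rw [← hca]; abel
    have h3 : a - (y - c) = z - y := by rw [ha]; abel
    rw [h2, h3] at h1
    have h4 : 0 < ‖z - y‖ := norm_pos_iff.2 (sub_ne_zero.2 hyz.symm)
    have h5 : dist y₁ y < dist y₁ z := by
      rw [hRs, dist_comm, dist_eq_norm]
      have := norm_nonneg (y - c)
      nlinarith [norm_nonneg (y - y₁)]
    refine lt_of_le_of_ne (hK y hyU) fun h => ?_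
    refine (hzmin y ?_ h).not_gt h5
    rw [mem_closedBall]
    have := dist_triangle y y₁ y₀
    rw [dist_comm y y₁] at this
    linarith
  -- a small ball around `z`, away from `c`
  obtain ⟨δ₀, hδ₀, hδ₀U⟩ := nhds_basis_closedBall.mem_iff.1 (hU.mem_nhds hzU)
  set δ : ℝ := min δ₀ (s / 2) with hδ
  have hδpos : 0 < δ := lt_min hδ₀ (half_pos hspos)
  have hδU : closedBall z δ ⊆ U := (closedBall_subset_closedBall (min_le_left _ _)).trans hδ₀U
  have hδs : δ ≤ s / 2 := min_le_right _ _
  have hdist : ∀ y ∈ closedBall z δ, s / 2 ≤ ‖y - c‖ ∧ ‖y - c‖ ≤ 2 * s := by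
    intro y hy
    rw [mem_closedBall, dist_eq_norm] at hy
    have h1 : y - c = a + (y - z) := by rw [ha]; abel
    have h2 := norm_add_le a (y - z)
    have h3 := norm_sub_le (a + (y - z)) (y - z)
    rw [add_sub_cancel_right] at h3
    rw [← h1] at h2 h3
    constructor <;> linarith
  -- `α` is so large that the barrier is a strict subsolution where `s / 2 ≤ ‖y - c‖ ≤ 2 s`
  obtain ⟨α, hα, hαbig⟩ : ∃ α : ℝ, 0 < α ∧ ∀ x : ℝ, s / 2 ≤ x → x ≤ 2 * s →
      0 < 2 * α * lam * x ^ 2 - Lam - C * x := by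
    have hq : 0 < 2 * lam * (s / 2) ^ 2 := by positivity
    refine ⟨(|Lam| + |C| * (2 * s) + 1) / (2 * lam * (s / 2) ^ 2), by positivity,
      fun x hx1 hx2 => ?_⟩
    set α := (|Lam| + |C| * (2 * s) + 1) / (2 * lam * (s / 2) ^ 2) with hαdef
    have hα : α * (2 * lam * (s / 2) ^ 2) = |Lam| + |C| * (2 * s) + 1 := div_mul_cancel₀ _ hq.ne'
    have hα0 : 0 < α := by positivity
    have h1 : 2 * α * lam * x ^ 2 ≥ |Lam| + |C| * (2 * s) + 1 := by
      rw [← hα]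
      have : (s / 2) ^ 2 ≤ x ^ 2 := by gcongr
      have h2 : 0 < 2 * α * lam := by positivity
      nlinarith
    have h2 : C * x ≤ |C| * (2 * s) :=
      (mul_le_mul_of_nonneg_right (le_abs_self C) (by linarith)).trans
        (mul_le_mul_of_nonneg_left hx2 (abs_nonneg C))
    linarith [le_abs_self Lam]
  set w : V → ℝ := fun y => Real.exp (-α * ‖y - c‖ ^ 2) with hw
  have hwsmooth : ContDiff ℝ 2 w :=
    (contDiff_const.mul ((contDiff_id.sub contDiff_const).norm_sq ℝ)).exp
  -- by compactness, `u` stays away from `K` on the part of the sphere inside the touching ball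
  obtain ⟨K', hK', hK'S⟩ : ∃ K' < K, ∀ y ∈ sphere z δ ∩ closedBall c s, u y ≤ K' := by
    have hScomp : IsCompact (sphere z δ ∩ closedBall c s) :=
      (isCompact_sphere z δ).inter_right isClosed_closedBall
    rcases (sphere z δ ∩ closedBall c s).eq_empty_or_nonempty with hS | hS
    · exact ⟨K - 1, by linarith, by simp [hS]⟩
    · obtain ⟨y, hy, hymax⟩ := hScomp.exists_isMaxOn hS (f := u) fun y hy =>
        (hu y (hδU (sphere_subset_closedBall hy.1))).continuousAt.continuousWithinAt
      refine ⟨u y, htouch y (hδU (sphere_subset_closedBall hy.1)) ?_ ?_, hymax⟩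
      · simpa [dist_eq_norm] using hy.2
      · rintro rfl
        have := hy.1
        simp only [mem_sphere, dist_self] at this
        exact hδpos.ne this
  set ε : ℝ := K - K' with hε
  have hεpos : 0 < ε := by linarith
  have hvsmooth : ∀ y ∈ U, ContDiffAt ℝ 2 (fun y => u y + ε * w y) y := fun y hy =>
    (hu y hy).add (contDiff_const.mul hwsmooth).contDiffAt
  obtain ⟨p, hp, hpmax⟩ := (isCompact_closedBall z δ).exists_isMaxOn
    ⟨z, mem_closedBall_self hδpos.le⟩ (f := fun y => u y + ε * w y) fun y hy =>
    (hvsmooth y (hδU hy)).continuousAt.continuousWithinAt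
  have hpz : u z + ε * w z ≤ u p + ε * w p := hpmax (mem_closedBall_self hδpos.le)
  -- the maximum of `u + ε w` is not attained on the sphere: inside the touching ball `u ≤ K - ε`
  -- and `w ≤ 1`, outside it `w < w z`
  have hpball : p ∈ ball z δ := by
    rw [← closedBall_sdiff_sphere]
    refine ⟨hp, fun hps => ?_⟩
    have hwz : w z = Real.exp (-α * s ^ 2) := rfl
    rcases le_or_gt ‖p - c‖ s with hpc | hpc
    · have h1 : u p ≤ K' := hK'S p ⟨hps, by simpa [dist_eq_norm] using hpc⟩
      have h2 : w p ≤ 1 := by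
        rw [hw, Real.exp_le_one_iff]
        have : 0 ≤ α * ‖p - c‖ ^ 2 := by positivity
        linarith
      have h3 : 0 < w z := Real.exp_pos _
      nlinarith
    · have h1 : u p ≤ K := hK p (hδU hp)
      have h2 : w p < w z := by
        rw [hwz, hw, Real.exp_lt_exp]
        have : s ^ 2 < ‖p - c‖ ^ 2 := by gcongr
        nlinarith
      nlinarith
  have hpU : p ∈ U := hδU hp
  have hloc : IsLocalMax (fun y => u y + ε * w y) p :=
    hpmax.isLocalMax (mem_of_superset (isOpen_ball.mem_nhds hpball) ball_subset_closedBall)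
  have hwp : ContDiffAt ℝ 2 (fun y => ε * w y) p := (contDiff_const.mul hwsmooth).contDiffAt
  obtain ⟨f, hf1, hf2, hf3⟩ := hL p hpU
  -- at `p`, `Du = -ε Dw` and `D²u ≤ -ε D²w`
  have hDw : fderiv ℝ w p = (-2 * α * w p) • innerSL ℝ (p - c) :=
    (hasFDerivAt_exp_neg_mul_norm_sub_sq α c p).fderiv
  have hDu : fderiv ℝ u p = -(ε • fderiv ℝ w p) := by
    have h1 := hloc.fderiv_eq_zero
    rw [fderiv_fun_add ((hu p hpU).differentiableAt (by simp)) (hwp.differentiableAt (by simp)),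
      fderiv_const_mul (hwsmooth.differentiable (by simp)).differentiableAt] at h1
    exact eq_neg_of_add_eq_zero_left h1
  have hDunorm : ‖fderiv ℝ u p‖ = ε * (2 * α * w p * ‖p - c‖) := by
    have hwpos : 0 < w p := Real.exp_pos _
    rw [hDu, norm_neg, norm_smul, hDw, norm_smul, innerSL_apply_norm, Real.norm_of_nonneg hεpos.le,
      Real.norm_of_nonpos (by nlinarith [mul_pos hα hwpos])]
    ring
  have hD2 : ∀ v, fderiv ℝ (fderiv ℝ u) p v v + ε * fderiv ℝ (fderiv ℝ w) p v v ≤ 0 := by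
    intro v
    have h1 := fderiv_fderiv_nonpos_of_isLocalMax (hvsmooth p hpU) hloc v
    have h2 : fderiv ℝ (fun y => u y + ε * w y) =ᶠ[𝓝 p]
        fun y => fderiv ℝ u y + ε • fderiv ℝ w y := by
      filter_upwards [hU.mem_nhds hpU] with y hy
      rw [fderiv_fun_add ((hu y hy).differentiableAt (by simp))
        ((contDiff_const.mul hwsmooth).differentiable (by simp)).differentiableAt,
        fderiv_const_mul (hwsmooth.differentiable (by simp)).differentiableAt]
    have h3 : DifferentiableAt ℝ (fderiv ℝ u) p :=
      ((hu p hpU).fderiv_right (m := 1) (by norm_num)).differentiableAt (by simp)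
    have h4 : DifferentiableAt ℝ (fderiv ℝ w) p :=
      (hwsmooth.contDiffAt.fderiv_right (m := 1) (by norm_num)).differentiableAt (by simp)
    rw [h2.fderiv_eq, fderiv_fun_add h3 (h4.fun_const_smul ε), fderiv_fun_const_smul h4] at h1
    simpa using h1
  have hsum : ∑ i, fderiv ℝ (fderiv ℝ w) p (f i) (f i)
      = w p * (4 * α ^ 2 * ∑ i, inner ℝ (p - c) (f i) ^ 2 - 2 * α * ∑ i, ‖f i‖ ^ 2) := by
    rw [mul_sub, Finset.mul_sum, Finset.mul_sum, Finset.mul_sum, Finset.mul_sum,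
      ← Finset.sum_sub_distrib]
    refine Finset.sum_congr rfl fun i _ => ?_
    rw [fderiv_fderiv_exp_neg_mul_norm_sub_sq]
    simp only [hw]
    ring
  have hsum2 : ∑ i, fderiv ℝ (fderiv ℝ u) p (f i) (f i)
      + ε * ∑ i, fderiv ℝ (fderiv ℝ w) p (f i) (f i) ≤ 0 := by
    rw [Finset.mul_sum, ← Finset.sum_add_distrib]
    exact Finset.sum_nonpos fun i _ => hD2 (f i)
  have hwpos : 0 < w p := Real.exp_pos _
  have hfinal := hαbig ‖p - c‖ (hdist p hp).1 (hdist p hp).2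
  have h6 : w p * (4 * α ^ 2 * (lam * ‖p - c‖ ^ 2) - 2 * α * Lam)
      ≤ ∑ i, fderiv ℝ (fderiv ℝ w) p (f i) (f i) := by
    rw [hsum]
    have := hf1 (p - c)
    gcongr
  rw [hDunorm] at hf3
  have h7 : 0 < ε * (2 * α * w p) * (2 * α * lam * ‖p - c‖ ^ 2 - Lam - C * ‖p - c‖) := by positivity
  have h8 := mul_le_mul_of_nonneg_left h6 hεpos.le
  nlinarith

end MaximumPrinciple

/-! ### Pulling back metrics in coordinates -/

section BilinearComp

variable {𝕜 : Type*} [NontriviallyNormedField 𝕜] {V W X Y : Type*}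
  [NormedAddCommGroup V] [NormedSpace 𝕜 V] [NormedAddCommGroup W] [NormedSpace 𝕜 W]
  [NormedAddCommGroup X] [NormedSpace 𝕜 X] [NormedAddCommGroup Y] [NormedSpace 𝕜 Y]

lemma contDiff_flip {n : WithTop ℕ∞} : ContDiff 𝕜 n (fun B : V →L[𝕜] W →L[𝕜] Y => B.flip) :=
  LinearIsometryEquiv.contDiff (𝕜 := 𝕜) (E := V →L[𝕜] W →L[𝕜] Y) (F := W →L[𝕜] V →L[𝕜] Y)
    (ContinuousLinearMap.flipₗᵢ 𝕜 V W Y)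

lemma ContDiffAt.bilinearComp_self {n : WithTop ℕ∞} {B : X → W →L[𝕜] W →L[𝕜] Y}
    {L : X → V →L[𝕜] W} {x : X} (hB : ContDiffAt 𝕜 n B x) (hL : ContDiffAt 𝕜 n L x) :
    ContDiffAt 𝕜 n (fun y => (B y).bilinearComp (L y) (L y)) x := by
  have h1 : ContDiffAt 𝕜 n (fun y => (B y).comp (L y)) x := hB.clm_comp hL
  have h2 : ContDiffAt 𝕜 n (fun y => ((B y).comp (L y)).flip) x :=
    contDiff_flip.contDiffAt.comp x h1
  have h3 : ContDiffAt 𝕜 n (fun y => (((B y).comp (L y)).flip.comp (L y))) x := h2.clm_comp hL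
  exact contDiff_flip.contDiffAt.comp x h3

end BilinearComp

section Pullback

variable {V W X : Type*} [NormedAddCommGroup V] [NormedSpace ℝ V]
  [NormedAddCommGroup W] [NormedSpace ℝ W] [NormedAddCommGroup X] [NormedSpace ℝ X]

@[simp] lemma pullbackForm_apply (B : W →L[ℝ] W →L[ℝ] ℝ) (L : V →L[ℝ] W) (v w : V) :
    pullbackForm B L v w = B (L v) (L w) := rfl

lemma ContDiffAt.pullbackForm {n : WithTop ℕ∞} {B : X → W →L[ℝ] W →L[ℝ] ℝ} {L : X → V →L[ℝ] W}
    {x : X} (hB : ContDiffAt ℝ n B x) (hL : ContDiffAt ℝ n L x) :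
    ContDiffAt ℝ n (fun y => pullbackForm (B y) (L y)) x :=
  hB.bilinearComp_self hL

lemma koszulForm_apply (G : V → V →L[ℝ] V →L[ℝ] ℝ) (y v w z : V) :
    koszulForm G y v w z
      = 2⁻¹ * (fderiv ℝ G y v w z + fderiv ℝ G y w v z - fderiv ℝ G y z v w) := rfl

lemma koszulForm_congr {G G' : V → V →L[ℝ] V →L[ℝ] ℝ} {y : V} (h : G =ᶠ[𝓝 y] G') (v w : V) :
    koszulForm G y v w = koszulForm G' y v w := by
  simp only [koszulForm, h.fderiv_eq]

lemma christoffel_congr {G G' : V → V →L[ℝ] V →L[ℝ] ℝ} {y : V} (h : G =ᶠ[𝓝 y] G') (v w : V) :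
    christoffel G y v w = christoffel G' y v w := by
  simp only [christoffel, koszulForm_congr h, h.eq_of_nhds]

lemma fderiv_pullbackForm_apply {G : W → W →L[ℝ] W →L[ℝ] ℝ} {F : V → W} {x : V}
    (hF : ContDiffAt ℝ 2 F x) (hG : ContDiffAt ℝ 1 G (F x)) (u v w : V) :
    fderiv ℝ (fun y => pullbackForm (G (F y)) (fderiv ℝ F y)) x u v w
      = fderiv ℝ G (F x) (fderiv ℝ F x u) (fderiv ℝ F x v) (fderiv ℝ F x w)
        + G (F x) (fderiv ℝ (fderiv ℝ F) x u v) (fderiv ℝ F x w)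
        + G (F x) (fderiv ℝ F x v) (fderiv ℝ (fderiv ℝ F) x u w) := by
  have hF1 : ContDiffAt ℝ 1 F x := hF.of_le (by norm_num)
  have hDF : ContDiffAt ℝ 1 (fderiv ℝ F) x := hF.fderiv_right (by norm_num)
  have hGF : ContDiffAt ℝ 1 (fun y => G (F y)) x := hG.comp x hF1
  have h1 : HasFDerivAt (fun y => pullbackForm (G (F y)) (fderiv ℝ F y)) _ x :=
    ((hGF.pullbackForm hDF).differentiableAt (by simp)).hasFDerivAt
  have h2 := (h1.clm_apply (hasFDerivAt_const v x)).clm_apply (hasFDerivAt_const w x)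
  have hD2 := (hDF.differentiableAt (by simp)).hasFDerivAt
  have hv := hD2.clm_apply (hasFDerivAt_const v x)
  have hw := hD2.clm_apply (hasFDerivAt_const w x)
  have hGF' : HasFDerivAt (fun y => G (F y)) ((fderiv ℝ G (F x)).comp (fderiv ℝ F x)) x :=
    (hG.differentiableAt (by simp)).hasFDerivAt.comp x (hF1.differentiableAt (by simp)).hasFDerivAt
  have h3 := (hGF'.clm_apply hv).clm_apply hw
  have h4 := congrArg (fun L : V →L[ℝ] ℝ => L u) (h2.unique h3)
  simp at h4
  rw [h4]
  ring

/-- Behaviour of the Koszul expression under pullback: the second derivative of the map enters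
because constant fields on the source are not related to constant fields on the target. -/
lemma koszulForm_pullbackForm {G : W → W →L[ℝ] W →L[ℝ] ℝ} {F : V → W} {x : V}
    (hF : ContDiffAt ℝ 2 F x) (hG : ContDiffAt ℝ 1 G (F x))
    (hsymm : ∀ a b, G (F x) a b = G (F x) b a) (v w z : V) :
    koszulForm (fun y => pullbackForm (G (F y)) (fderiv ℝ F y)) x v w z
      = koszulForm G (F x) (fderiv ℝ F x v) (fderiv ℝ F x w) (fderiv ℝ F x z)
        + G (F x) (fderiv ℝ (fderiv ℝ F) x v w) (fderiv ℝ F x z) := by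
  have hs : IsSymmSndFDerivAt ℝ F x := hF.isSymmSndFDerivAt (by simp)
  simp only [koszulForm_apply, fderiv_pullbackForm_apply hF hG]
  rw [hs.eq w v, hs.eq z v, hs.eq z w, hsymm (fderiv ℝ F x w), hsymm (fderiv ℝ F x v)]
  ring

lemma isInvertible_of_nondegenerate [FiniteDimensional ℝ V] {B : V →L[ℝ] V →L[ℝ] ℝ}
    (hB : ∀ v, (∀ w, B v w = 0) → v = 0) : B.IsInvertible := by
  have hinj : Function.Injective B := by
    rw [injective_iff_map_eq_zero]
    exact fun v hv => hB v fun w => by rw [hv]; rfl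
  have hfin : Module.finrank ℝ V = Module.finrank ℝ (V →L[ℝ] ℝ) := by
    rw [← (LinearMap.toContinuousLinearMap (𝕜 := ℝ) (E := V) (F' := ℝ)).finrank_eq]
    exact (Subspace.dual_finrank_eq (K := ℝ) (V := V)).symm
  exact ⟨(LinearEquiv.ofInjectiveOfFinrankEq (B : V →ₗ[ℝ] V →L[ℝ] ℝ) hinj
    hfin).toContinuousLinearEquiv, by ext; rfl⟩

lemma apply_christoffel {G : V → V →L[ℝ] V →L[ℝ] ℝ} {y : V} (hG : (G y).IsInvertible) (v w z : V) :
    G y (christoffel G y v w) z = koszulForm G y v w z := by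
  rw [christoffel, hG.self_apply_inverse]

/-- Gauss formula: for a metric induced by an immersion `F`, the tangential part of the ambient
covariant derivative `D²F(v, w) + Γ̄(DF v, DF w)` is the intrinsic one. -/
lemma apply_sndFDeriv_add_christoffel [FiniteDimensional ℝ V] {G : W → W →L[ℝ] W →L[ℝ] ℝ}
    {F : V → W} {x : V}
    (hF : ContDiffAt ℝ 2 F x) (hG : ContDiffAt ℝ 1 G (F x))
    (hsymm : ∀ a b, G (F x) a b = G (F x) b a) (hinv : (G (F x)).IsInvertible)
    {g : V → V →L[ℝ] V →L[ℝ] ℝ} (hg : g =ᶠ[𝓝 x] fun y => pullbackForm (G (F y)) (fderiv ℝ F y))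
    (hginv : (g x).IsInvertible) (v w z : V) :
    G (F x) (fderiv ℝ (fderiv ℝ F) x v w
        + christoffel G (F x) (fderiv ℝ F x v) (fderiv ℝ F x w)
        - fderiv ℝ F x (christoffel g x v w)) (fderiv ℝ F x z) = 0 := by
  have h1 := apply_christoffel hginv v w z
  rw [koszulForm_congr hg, koszulForm_pullbackForm hF hG hsymm] at h1
  nth_rewrite 1 [hg.eq_of_nhds] at h1
  rw [pullbackForm_apply] at h1
  simp only [map_sub, map_add, sub_apply, add_apply]
  rw [h1, apply_christoffel hinv]
  ring

/-- The transformation law of the Christoffel symbols under a change of coordinates `κ`. -/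
lemma fderiv_christoffel_of_pullback [FiniteDimensional ℝ V] [FiniteDimensional ℝ W]
    {G : W → W →L[ℝ] W →L[ℝ] ℝ}
    {κ : V → W} {x : V} (hκ : ContDiffAt ℝ 2 κ x) (hG : ContDiffAt ℝ 1 G (κ x))
    (hsymm : ∀ a b, G (κ x) a b = G (κ x) b a) (hpos : ∀ a, a ≠ 0 → 0 < G (κ x) a a)
    (hsurj : Function.Surjective (fderiv ℝ κ x))
    {g : V → V →L[ℝ] V →L[ℝ] ℝ} (hg : g =ᶠ[𝓝 x] fun y => pullbackForm (G (κ y)) (fderiv ℝ κ y))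
    (hginv : (g x).IsInvertible) (v w : V) :
    fderiv ℝ κ x (christoffel g x v w) = fderiv ℝ (fderiv ℝ κ) x v w
        + christoffel G (κ x) (fderiv ℝ κ x v) (fderiv ℝ κ x w) := by
  have hinv : (G (κ x)).IsInvertible := isInvertible_of_nondegenerate fun a ha => by
    by_contra h
    exact (hpos a h).ne' (ha a)
  set d := fderiv ℝ (fderiv ℝ κ) x v w
        + christoffel G (κ x) (fderiv ℝ κ x v) (fderiv ℝ κ x w)
        - fderiv ℝ κ x (christoffel g x v w) with hd
  obtain ⟨z, hz⟩ := hsurj d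
  have h := apply_sndFDeriv_add_christoffel hκ hG hsymm hinv hg hginv v w z
  rw [← hd, hz] at h
  have hd0 : d = 0 := by
    by_contra h0
    exact (hpos d h0).ne' h
  exact (sub_eq_zero.1 hd0).symm

/-- The Hessian of a function is invariant under a change of coordinates `κ`. -/
lemma hessian_comp [FiniteDimensional ℝ V] [FiniteDimensional ℝ W]
    {G : W → W →L[ℝ] W →L[ℝ] ℝ}
    {κ : V → W} {x : V} (hκ : ContDiffAt ℝ 2 κ x) (hG : ContDiffAt ℝ 1 G (κ x))
    (hsymm : ∀ a b, G (κ x) a b = G (κ x) b a) (hpos : ∀ a, a ≠ 0 → 0 < G (κ x) a a)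
    (hsurj : Function.Surjective (fderiv ℝ κ x))
    {g : V → V →L[ℝ] V →L[ℝ] ℝ} (hg : g =ᶠ[𝓝 x] fun y => pullbackForm (G (κ y)) (fderiv ℝ κ y))
    (hginv : (g x).IsInvertible) {u : V → ℝ} {u' : W → ℝ} (hu' : ContDiffAt ℝ 2 u' (κ x))
    (hu : u =ᶠ[𝓝 x] u' ∘ κ) (v w : V) :
    fderiv ℝ (fderiv ℝ u) x v w - fderiv ℝ u x (christoffel g x v w)
      = fderiv ℝ (fderiv ℝ u') (κ x) (fderiv ℝ κ x v) (fderiv ℝ κ x w)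
        - fderiv ℝ u' (κ x) (christoffel G (κ x) (fderiv ℝ κ x v) (fderiv ℝ κ x w)) := by
  have h1 : fderiv ℝ u =ᶠ[𝓝 x] fun y => (fderiv ℝ u' (κ y)).comp (fderiv ℝ κ y) := by
    refine hu.fderiv.trans ?_
    filter_upwards [hκ.eventually (by simp),
      hκ.continuousAt.eventually (hu'.eventually (by simp))] with y hy hy'
    exact fderiv_comp y (hy'.differentiableAt (by simp)) (hy.differentiableAt (by simp))
  have hDu' : HasFDerivAt (fderiv ℝ u') (fderiv ℝ (fderiv ℝ u') (κ x)) (κ x) :=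
    ((hu'.fderiv_right (m := 1) (by norm_num)).differentiableAt (by simp)).hasFDerivAt
  have hDκ : HasFDerivAt (fderiv ℝ κ) (fderiv ℝ (fderiv ℝ κ) x) x :=
    ((hκ.fderiv_right (m := 1) (by norm_num)).differentiableAt (by simp)).hasFDerivAt
  have hκ1 : HasFDerivAt κ (fderiv ℝ κ x) x := (hκ.differentiableAt (by simp)).hasFDerivAt
  have h2 := (hDu'.comp x hκ1).clm_comp hDκ
  simp only [Function.comp_apply] at h2
  rw [h1.fderiv_eq, h2.fderiv, h1.eq_of_nhds]
  simp only [ContinuousLinearMap.comp_apply]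
  rw [fderiv_christoffel_of_pullback hκ hG hsymm hpos hsurj hg hginv]
  simp

end Pullback

/-! ### Orthonormal frames -/

section Frames

variable {V W : Type*} [NormedAddCommGroup V] [NormedSpace ℝ V]
  [NormedAddCommGroup W] [NormedSpace ℝ W] {ι : Type*}

/-- The family `f` is orthonormal for the bilinear form `B`. -/
def IsOrthonormalFrame [DecidableEq ι] (B : V →L[ℝ] V →L[ℝ] ℝ) (f : ι → V) : Prop :=
  ∀ i j, B (f i) (f j) = if i = j then 1 else 0

lemma IsOrthonormalFrame.map [DecidableEq ι] {B : W →L[ℝ] W →L[ℝ] ℝ} {L : V →L[ℝ] W} {f : ι → V}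
    (hf : IsOrthonormalFrame (pullbackForm B L) f) : IsOrthonormalFrame B fun i => L (f i) := hf

lemma exists_isOrthonormalFrame [FiniteDimensional ℝ V] {B : V →L[ℝ] V →L[ℝ] ℝ}
    (hsymm : ∀ v w, B v w = B w v) (hpos : ∀ v, v ≠ 0 → 0 < B v v) {m : ℕ}
    (hm : Module.finrank ℝ V = m) : ∃ f : Fin m → V, IsOrthonormalFrame B f := by
  subst hm
  let B' : LinearMap.BilinForm ℝ V := ContinuousLinearMap.toBilinForm B
  have hB' : ∀ v w, B' v w = B v w := fun v w => rfl
  obtain ⟨b, hb⟩ := LinearMap.BilinForm.exists_orthogonal_basis (B := B') ⟨fun v w => hsymm v w⟩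
  refine ⟨fun i => (Real.sqrt (B (b i) (b i)))⁻¹ • b i, fun i j => ?_⟩
  have hi := hpos (b i) (b.ne_zero i)
  split_ifs with h
  · subst h
    simp only [map_smul, smul_apply, smul_eq_mul]
    rw [← mul_assoc, ← mul_inv, Real.mul_self_sqrt hi.le, inv_mul_cancel₀ hi.ne']
  · have : B (b i) (b j) = 0 := hb h
    simp [this]

variable [Fintype ι] [DecidableEq ι]

lemma IsOrthonormalFrame.apply_sum {B : V →L[ℝ] V →L[ℝ] ℝ} {f : ι → V}
    (hf : IsOrthonormalFrame B f) (c : ι → ℝ) (j : ι) : B (∑ i, c i • f i) (f j) = c j := by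
  simp [map_sum, sum_apply, hf _ _]

lemma IsOrthonormalFrame.apply_sum_sum {B : V →L[ℝ] V →L[ℝ] ℝ} {f : ι → V}
    (hf : IsOrthonormalFrame B f) (c : ι → ℝ) :
    B (∑ i, c i • f i) (∑ i, c i • f i) = ∑ i, c i ^ 2 := by
  rw [map_sum (B _)]
  simp only [map_smul, smul_eq_mul, hf.apply_sum, sq]

lemma IsOrthonormalFrame.linearIndependent {B : V →L[ℝ] V →L[ℝ] ℝ} {f : ι → V}
    (hf : IsOrthonormalFrame B f) : LinearIndependent ℝ f := by
  rw [Fintype.linearIndependent_iff]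
  intro c hc i
  rw [← hf.apply_sum c i, hc]
  simp

lemma IsOrthonormalFrame.exists_sum_eq [FiniteDimensional ℝ V] {B : V →L[ℝ] V →L[ℝ] ℝ} {f : ι → V}
    (hf : IsOrthonormalFrame B f) (hcard : Fintype.card ι = Module.finrank ℝ V) (z : V) :
    ∃ c : ι → ℝ, ∑ i, c i • f i = z := by
  have h := hf.linearIndependent.span_eq_top_of_card_eq_finrank' hcard
  exact (Submodule.mem_span_range_iff_exists_fun ℝ).1 (h ▸ Submodule.mem_top)

/-- The trace with respect to `B` computed with the inverse Gram matrix of a basis `e` is the trace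
over an orthonormal frame. -/
lemma sum_inv_gram_smul_eq_sum_frame {B : V →L[ℝ] V →L[ℝ] ℝ} {e f : ι → V}
    (hf : IsOrthonormalFrame B f) (he : ∀ v, ∃ c : ι → ℝ, ∑ i, c i • e i = v)
    (X : V →ₗ[ℝ] V →ₗ[ℝ] W) :
    ∑ i, ∑ j, (Matrix.of fun i j => B (e i) (e j))⁻¹ i j • X (e i) (e j) = ∑ k, X (f k) (f k) := by
  choose c hc using fun k => he (f k)
  set S : Matrix ι ι ℝ := Matrix.of fun i k => c k i with hS
  set G : Matrix ι ι ℝ := Matrix.of fun i j => B (e i) (e j) with hG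
  have h1 : S.transpose * G * S = 1 := by
    ext k l
    have := hf k l
    rw [← hc k, ← hc l] at this
    simp only [map_sum, map_smul, sum_apply, smul_apply, smul_eq_mul] at this
    rw [Matrix.one_apply, ← this, Matrix.mul_apply]
    refine Finset.sum_congr rfl fun j _ => ?_
    rw [Matrix.mul_apply, mul_comm]
    rfl
  have h2 : G⁻¹ = S * S.transpose := by
    refine Matrix.inv_eq_left_inv ?_
    rw [Matrix.mul_assoc]
    exact mul_eq_one_comm.1 h1
  have h3 : ∀ k, X (f k) (f k) = ∑ i, ∑ j, (c k i * c k j) • X (e i) (e j) := by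
    intro k
    rw [← hc k]
    simp only [map_sum, map_smul, LinearMap.sum_apply, LinearMap.smul_apply, Finset.smul_sum,
      smul_smul]
    rw [Finset.sum_comm]
    refine Finset.sum_congr rfl fun i _ => Finset.sum_congr rfl fun j _ => ?_
    rw [mul_comm]
  simp only [h3]
  symm
  rw [Finset.sum_comm]
  refine Finset.sum_congr rfl fun i _ => ?_
  rw [Finset.sum_comm]
  refine Finset.sum_congr rfl fun j _ => ?_
  rw [← Finset.sum_smul, h2, Matrix.mul_apply]
  rfl

end Frames

section FrameBounds

variable {V : Type*} [NormedAddCommGroup V] [InnerProductSpace ℝ V]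
  {ι : Type*} [Fintype ι] [DecidableEq ι]

/-- An upper bound for a metric makes its orthonormal frames uniformly elliptic. -/
lemma IsOrthonormalFrame.norm_sq_le_sum_inner_sq [FiniteDimensional ℝ V]
    {B : V →L[ℝ] V →L[ℝ] ℝ} {f : ι → V}
    (hf : IsOrthonormalFrame B f) {Lam : ℝ} (hLam : 0 < Lam) (hB : ∀ v, B v v ≤ Lam * ‖v‖ ^ 2)
    (hcard : Fintype.card ι = Module.finrank ℝ V) (z : V) :
    Lam⁻¹ * ‖z‖ ^ 2 ≤ ∑ i, inner ℝ z (f i) ^ 2 := by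
  obtain ⟨c, hc⟩ := hf.exists_sum_eq hcard z
  have h1 : ‖z‖ ^ 2 = ∑ i, c i * inner ℝ z (f i) := by
    rw [← real_inner_self_eq_norm_sq]
    nth_rewrite 2 [← hc]
    rw [inner_sum]
    simp only [real_inner_smul_right]
  have h2 : (∑ i, c i * inner ℝ z (f i)) ^ 2 ≤ (∑ i, c i ^ 2) * ∑ i, inner ℝ z (f i) ^ 2 :=
    Finset.sum_mul_sq_le_sq_mul_sq _ _ _
  have h3 : ∑ i, c i ^ 2 ≤ Lam * ‖z‖ ^ 2 := by
    rw [← hf.apply_sum_sum c, hc]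
    exact hB z
  set T := ∑ i, inner ℝ z (f i) ^ 2 with hT
  have hT0 : 0 ≤ T := Finset.sum_nonneg fun i _ => sq_nonneg _
  rw [← h1] at h2
  rcases eq_or_ne z 0 with rfl | hz
  · simpa using hT0
  · have hz2 : 0 < ‖z‖ ^ 2 := by positivity
    have h4 : ‖z‖ ^ 2 * ‖z‖ ^ 2 ≤ ‖z‖ ^ 2 * (Lam * T) := by nlinarith
    have h5 := le_of_mul_le_mul_left h4 hz2
    rw [inv_mul_le_iff₀ hLam]
    exact h5

lemma IsOrthonormalFrame.sum_norm_sq_le {B : V →L[ℝ] V →L[ℝ] ℝ} {f : ι → V}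
    (hf : IsOrthonormalFrame B f) {lam : ℝ} (hlam : 0 < lam) (hB : ∀ v, lam * ‖v‖ ^ 2 ≤ B v v) :
    ∑ i, ‖f i‖ ^ 2 ≤ Fintype.card ι * lam⁻¹ := by
  have : ∀ i ∈ Finset.univ, ‖f i‖ ^ 2 ≤ lam⁻¹ := fun i _ => by
    have h := hB (f i)
    rw [hf i i, if_pos rfl] at h
    rw [← one_div, le_div_iff₀ hlam]
    linarith
  simpa using Finset.sum_le_sum this

end FrameBounds

/-! ### Local bounds for metrics and Christoffel symbols -/

section LocalBounds

variable {V : Type*} [NormedAddCommGroup V] [NormedSpace ℝ V]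

lemma abs_koszulForm_le (G : V → V →L[ℝ] V →L[ℝ] ℝ) (y v w z : V) :
    |koszulForm G y v w z| ≤ 3 / 2 * ‖fderiv ℝ G y‖ * ‖v‖ * ‖w‖ * ‖z‖ := by
  have hb : ∀ a b c : V, |fderiv ℝ G y a b c| ≤ ‖fderiv ℝ G y‖ * ‖a‖ * ‖b‖ * ‖c‖ := fun a b c => by
    have h1 := (fderiv ℝ G y a b).le_opNorm c
    have h2 := (fderiv ℝ G y a).le_opNorm b
    have h3 := (fderiv ℝ G y).le_opNorm a
    calc |fderiv ℝ G y a b c| ≤ ‖fderiv ℝ G y a b‖ * ‖c‖ := h1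
      _ ≤ ‖fderiv ℝ G y a‖ * ‖b‖ * ‖c‖ := by gcongr
      _ ≤ ‖fderiv ℝ G y‖ * ‖a‖ * ‖b‖ * ‖c‖ := by gcongr
  rw [koszulForm_apply]
  have h1 := abs_le.1 (hb v w z)
  have h2 := abs_le.1 (hb w v z)
  have h3 := abs_le.1 (hb z v w)
  rw [abs_le]
  constructor <;> nlinarith

/-- Uniform bounds near a point for a Riemannian metric and its Christoffel symbols. -/
lemma exists_eventually_metric_bounds [FiniteDimensional ℝ V] {G : V → V →L[ℝ] V →L[ℝ] ℝ} {x : V}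
    (hG : ContDiffAt ℝ 1 G x) (hpos : ∀ v, v ≠ 0 → 0 < G x v v) :
    ∃ lam Lam C : ℝ, 0 < lam ∧ 0 < Lam ∧ 0 ≤ C ∧ ∀ᶠ y in 𝓝 x,
      (∀ v, lam * ‖v‖ ^ 2 ≤ G y v v) ∧ (∀ v, G y v v ≤ Lam * ‖v‖ ^ 2) ∧
      ∀ v w, ‖christoffel G y v w‖ ≤ C * ‖v‖ * ‖w‖ := by
  obtain ⟨l, hl, hlx⟩ : ∃ l > 0, ∀ v, l * ‖v‖ ^ 2 ≤ G x v v := by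
    have hc : Continuous fun v => G x v v := by fun_prop
    rcases (sphere (0 : V) 1).eq_empty_or_nonempty with h | h
    · refine ⟨1, one_pos, fun v => ?_⟩
      rcases eq_or_ne v 0 with rfl | hv
      · simp
      · have : ‖v‖⁻¹ • v ∈ sphere (0 : V) 1 := by
          simp [norm_smul, inv_mul_cancel₀ (norm_ne_zero_iff.2 hv)]
        simp [h] at this
    · obtain ⟨v₀, hv₀, hmin⟩ := (isCompact_sphere (0 : V) 1).exists_isMinOn h hc.continuousOn
      refine ⟨G x v₀ v₀, hpos v₀ fun h0 => by simp [h0] at hv₀, fun v => ?_⟩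
      rcases eq_or_ne v 0 with rfl | hv
      · simp
      · have hv' := norm_ne_zero_iff.2 hv
        have h1 : ‖v‖⁻¹ • v ∈ sphere (0 : V) 1 := by
          simp [norm_smul, inv_mul_cancel₀ hv']
        have h2 : G x v₀ v₀ ≤ G x (‖v‖⁻¹ • v) (‖v‖⁻¹ • v) := hmin h1
        simp only [map_smul, smul_apply, smul_eq_mul] at h2
        have h3 := mul_le_mul_of_nonneg_right h2 (sq_nonneg ‖v‖)
        calc _ ≤ _ := h3
          _ = G x v v := by field_simp
  have hcont : ContinuousAt G x := hG.continuousAt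
  have hD : ContinuousAt (fderiv ℝ G) x := (hG.fderiv_right (m := 0) (by norm_num)).continuousAt
  have e1 : ∀ᶠ y in 𝓝 x, ‖G y - G x‖ < l / 2 :=
    (tendsto_iff_norm_sub_tendsto_zero.1 hcont).eventually_lt_const (half_pos hl)
  have e2 : ∀ᶠ y in 𝓝 x, ‖fderiv ℝ G y‖ < ‖fderiv ℝ G x‖ + 1 :=
    hD.norm.eventually_lt_const (lt_add_one _)
  refine ⟨l / 2, ‖G x‖ + l / 2, 3 / 2 * (‖fderiv ℝ G x‖ + 1) / (l / 2), half_pos hl, by positivity,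
    by positivity, ?_⟩
  filter_upwards [e1, e2] with y h1 h2
  have hdiff : ∀ v, |G y v v - G x v v| ≤ l / 2 * ‖v‖ ^ 2 := fun v => by
    have h3 := (G y - G x).le_opNorm v
    have h4 := ((G y - G x) v).le_opNorm v
    calc |G y v v - G x v v| = ‖(G y - G x) v v‖ := by simp
      _ ≤ ‖(G y - G x) v‖ * ‖v‖ := h4
      _ ≤ ‖G y - G x‖ * ‖v‖ * ‖v‖ := by gcongr
      _ ≤ l / 2 * ‖v‖ * ‖v‖ := by gcongr
      _ = l / 2 * ‖v‖ ^ 2 := by ring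
  have hlow : ∀ v, l / 2 * ‖v‖ ^ 2 ≤ G y v v := fun v => by
    have := (abs_le.1 (hdiff v)).1
    linarith [hlx v]
  refine ⟨hlow, fun v => ?_, fun v w => ?_⟩
  · have h3 := (G x).le_opNorm v
    have h4 := (le_abs_self _).trans ((G x v).le_opNorm v)
    have h5 := (abs_le.1 (hdiff v)).2
    have h6 : ‖G x v‖ * ‖v‖ ≤ ‖G x‖ * ‖v‖ * ‖v‖ := by gcongr
    nlinarith
  · have hinv : (G y).IsInvertible := isInvertible_of_nondegenerate fun a ha => by
      have h3 := hlow a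
      rw [ha a] at h3
      have h4 : ‖a‖ ^ 2 ≤ 0 := by nlinarith
      simpa using h4.antisymm (sq_nonneg _)
    set c := christoffel G y v w with hc
    have h3 : G y c c = koszulForm G y v w c := apply_christoffel hinv v w c
    have h4 := (le_abs_self _).trans (abs_koszulForm_le G y v w c)
    rw [← h3] at h4
    have h5 := hlow c
    have h6 : 3 / 2 * ‖fderiv ℝ G y‖ * ‖v‖ * ‖w‖ * ‖c‖
        ≤ 3 / 2 * (‖fderiv ℝ G x‖ + 1) * ‖v‖ * ‖w‖ * ‖c‖ := by gcongr
    rcases (norm_nonneg c).eq_or_lt with h0 | h0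
    · rw [← h0]; positivity
    · have h7 : l / 2 * ‖c‖ ≤ 3 / 2 * (‖fderiv ℝ G x‖ + 1) * ‖v‖ * ‖w‖ := by
        refine le_of_mul_le_mul_right ?_ h0
        nlinarith
      rw [div_mul_eq_mul_div, div_mul_eq_mul_div, le_div_iff₀ (half_pos hl)]
      linarith

end LocalBounds

/-! ### Doubly warped metrics in coordinates -/

section Warped

variable {V V' : Type*} [NormedAddCommGroup V] [NormedSpace ℝ V]
  [NormedAddCommGroup V'] [NormedSpace ℝ V']

/-- The doubly warped metric `-η² dt² + ρ² S` on `ℝ × V'`, where `S` is a metric on an open subset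
of the vector space `V'`. -/
noncomputable def warpedForm (η : V' → ℝ) (ρ : ℝ → ℝ) (S : V' → V' →L[ℝ] V' →L[ℝ] ℝ) (p : ℝ × V') :
    (ℝ × V') →L[ℝ] (ℝ × V') →L[ℝ] ℝ :=
  -(η p.2 ^ 2) • pullbackForm (ContinuousLinearMap.mul ℝ ℝ) (ContinuousLinearMap.fst ℝ ℝ V')
    + (ρ p.1 ^ 2) • pullbackForm (S p.2) (ContinuousLinearMap.snd ℝ ℝ V')

variable {η : V' → ℝ} {ρ : ℝ → ℝ} {S : V' → V' →L[ℝ] V' →L[ℝ] ℝ} {p : ℝ × V'}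

lemma warpedForm_apply (p v w : ℝ × V') :
    warpedForm η ρ S p v w = -(η p.2 ^ 2) * (v.1 * w.1) + ρ p.1 ^ 2 * S p.2 v.2 w.2 := rfl

lemma warpedForm_symm (hS : ∀ a b, S p.2 a b = S p.2 b a) (v w : ℝ × V') :
    warpedForm η ρ S p v w = warpedForm η ρ S p w v := by
  rw [warpedForm_apply, warpedForm_apply, hS, mul_comm v.1]

lemma warpedForm_isInvertible [FiniteDimensional ℝ V'] (hη : 0 < η p.2) (hρ : 0 < ρ p.1)
    (hS : ∀ a, a ≠ 0 → 0 < S p.2 a a) : (warpedForm η ρ S p).IsInvertible := by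
  refine isInvertible_of_nondegenerate fun v hv => ?_
  have h1 := hv (1, 0)
  have h2 := hv (0, v.2)
  simp only [warpedForm_apply, map_zero, mul_zero, add_zero, mul_one, zero_add] at h1 h2
  have h3 : v.1 = 0 := by
    rcases mul_eq_zero.1 h1 with h | h
    · exact absurd h (neg_ne_zero.2 (pow_pos hη 2).ne')
    · exact h
  have h4 : v.2 = 0 := by
    by_contra h
    rcases mul_eq_zero.1 h2 with h' | h'
    · exact (pow_pos hρ 2).ne' h'
    · exact (hS _ h).ne' h'
  exact Prod.ext h3 h4

lemma ContDiffAt.warpedForm {n : WithTop ℕ∞} (hη : ContDiffAt ℝ n η p.2) (hρ : ContDiffAt ℝ n ρ p.1)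
    (hS : ContDiffAt ℝ n S p.2) : ContDiffAt ℝ n (warpedForm η ρ S) p := by
  have hη' : ContDiffAt ℝ n (fun q : ℝ × V' => η q.2) p := hη.comp p contDiffAt_snd
  have hρ' : ContDiffAt ℝ n (fun q : ℝ × V' => ρ q.1) p := hρ.comp p contDiffAt_fst
  have hS' : ContDiffAt ℝ n (fun q : ℝ × V' => S q.2) p := hS.comp p contDiffAt_snd
  exact ((hη'.pow 2).neg.smul contDiffAt_const).add
    ((hρ'.pow 2).smul (hS'.pullbackForm contDiffAt_const))

lemma fderiv_warpedForm_apply (hη : ContDiffAt ℝ 1 η p.2) (hρ : ContDiffAt ℝ 1 ρ p.1)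
    (hS : ContDiffAt ℝ 1 S p.2) (u v w : ℝ × V') :
    fderiv ℝ (warpedForm η ρ S) p u v w
      = -(2 * η p.2 * fderiv ℝ η p.2 u.2) * (v.1 * w.1)
        + 2 * ρ p.1 * deriv ρ p.1 * u.1 * S p.2 v.2 w.2
        + ρ p.1 ^ 2 * fderiv ℝ S p.2 u.2 v.2 w.2 := by
  have h1 : HasFDerivAt (warpedForm η ρ S) _ p :=
    ((hη.warpedForm hρ hS).differentiableAt (by simp)).hasFDerivAt
  have h2 := (h1.clm_apply (hasFDerivAt_const v p)).clm_apply (hasFDerivAt_const w p)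
  have hη' := (hη.differentiableAt (by simp)).hasFDerivAt.comp p (hasFDerivAt_snd (𝕜 := ℝ))
  have hρ' := (hρ.differentiableAt (by simp)).hasDerivAt.hasFDerivAt.comp p
    (hasFDerivAt_fst (𝕜 := ℝ))
  have hS' := (((hS.differentiableAt (by simp)).hasFDerivAt.comp p
    (hasFDerivAt_snd (𝕜 := ℝ))).clm_apply (hasFDerivAt_const v.2 p)).clm_apply
    (hasFDerivAt_const w.2 p)
  have h3 := ((hη'.pow 2).neg.mul_const (v.1 * w.1)).add ((hρ'.pow 2).mul hS')
  have h4 := congrArg (fun L : (ℝ × V') →L[ℝ] ℝ => L u) (h2.unique h3)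
  simp at h4
  rw [h4]
  ring

/-- The Koszul expression of a doubly warped metric, paired with `∂_t = (1, 0)`. -/
lemma koszulForm_warpedForm_dt (hη : ContDiffAt ℝ 1 η p.2) (hρ : ContDiffAt ℝ 1 ρ p.1)
    (hS : ContDiffAt ℝ 1 S p.2) (v w : ℝ × V') :
    koszulForm (warpedForm η ρ S) p v w (1, 0)
      = -(η p.2 * (fderiv ℝ η p.2 v.2 * w.1 + fderiv ℝ η p.2 w.2 * v.1))
        - ρ p.1 * deriv ρ p.1 * S p.2 v.2 w.2 := by
  rw [koszulForm_apply]
  simp only [fderiv_warpedForm_apply hη hρ hS, map_zero, zero_apply]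
  ring

/-- The time component of the Christoffel symbols of a doubly warped metric. -/
lemma christoffel_warpedForm_fst [FiniteDimensional ℝ V'] (hη : ContDiffAt ℝ 1 η p.2)
    (hρ : ContDiffAt ℝ 1 ρ p.1) (hS : ContDiffAt ℝ 1 S p.2) (hη0 : 0 < η p.2) (hρ0 : 0 < ρ p.1)
    (hpos : ∀ a, a ≠ 0 → 0 < S p.2 a a) (v w : ℝ × V') :
    (christoffel (warpedForm η ρ S) p v w).1
      = (fderiv ℝ η p.2 v.2 * w.1 + fderiv ℝ η p.2 w.2 * v.1) / η p.2
        + ρ p.1 * deriv ρ p.1 * S p.2 v.2 w.2 / η p.2 ^ 2 := by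
  have h := apply_christoffel
    (warpedForm_isInvertible (η := η) (ρ := ρ) (S := S) hη0 hρ0 hpos) v w ((1 : ℝ), (0 : V'))
  rw [koszulForm_warpedForm_dt hη hρ hS, warpedForm_apply] at h
  simp only [map_zero, mul_zero, add_zero, mul_one] at h
  field_simp
  linarith

/-- The future unit normal of a spacelike hypersurface is the normalized projection of `∂_t` to the
normal line; its scalar product with a normal vector is thus read off from the time component. -/
lemma exists_warped_unit_normal {ι : Type*} [Fintype ι] [DecidableEq ι]
    (hη0 : 0 < η p.2) (hsymm : ∀ a b, S p.2 a b = S p.2 b a) {L : V →L[ℝ] ℝ × V'} {f : ι → V}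
    (hf : IsOrthonormalFrame (pullbackForm (warpedForm η ρ S p) L) f)
    (hspan : ∀ v, ∃ c : ι → ℝ, ∑ i, c i • f i = v) :
    ∃ ν, (∀ v, warpedForm η ρ S p ν (L v) = 0) ∧ warpedForm η ρ S p ν ν = -1 ∧
      warpedForm η ρ S p ν (1, 0) < 0 ∧
      ∀ X, (∀ v, warpedForm η ρ S p X (L v) = 0) →
        warpedForm η ρ S p X ν
          = -(η p.2 / Real.sqrt (1 + η p.2 ^ 2 * ∑ i, (L (f i)).1 ^ 2)) * X.1 := by
  set B := warpedForm η ρ S p with hB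
  set e : ℝ := η p.2
  have hBs : ∀ v w, B v w = B w v := warpedForm_symm hsymm
  have hBt : ∀ X : ℝ × V', B X (1, 0) = -(e ^ 2) * X.1 := fun X => by
    rw [hB, warpedForm_apply]
    simp [e]
  set Q : ℝ := ∑ i, (L (f i)).1 ^ 2 with hQ
  have hQ0 : 0 ≤ Q := Finset.sum_nonneg fun i _ => sq_nonneg _
  set c : ℝ := Real.sqrt (1 + e ^ 2 * Q) with hc
  have hc2 : c ^ 2 = 1 + e ^ 2 * Q := Real.sq_sqrt (by positivity)
  have hc0 : 0 < c := Real.sqrt_pos.2 (by positivity)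
  set t : ℝ × V' := (1, 0) with ht
  set T : V := ∑ i, B t (L (f i)) • f i with hT
  -- `L T` is the tangential part of `∂_t`
  set ν₀ : ℝ × V' := t - L T with hν₀
  have hnorm : ∀ v, B ν₀ (L v) = 0 := by
    intro v
    obtain ⟨a, ha⟩ := hspan v
    rw [← ha]
    simp only [map_sum, map_smul]
    refine Finset.sum_eq_zero fun j _ => ?_
    have h1 := hf.apply_sum (fun i => B t (L (f i))) j
    rw [pullbackForm_apply] at h1
    rw [hν₀, map_sub, sub_apply, h1, sub_self, smul_zero]
  have hν₀t : B ν₀ t = -(e ^ 2 * c ^ 2) := by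
    have h1 : B t (L T) = e ^ 4 * Q := by
      rw [hT]
      simp only [map_sum, map_smul, smul_eq_mul]
      rw [hQ, Finset.mul_sum]
      refine Finset.sum_congr rfl fun i _ => ?_
      rw [hBs t, hBt]
      ring
    rw [hBs, hν₀, map_sub, hBt, h1, hc2]
    simp only [ht]
    ring
  have hν₀ν₀ : B ν₀ ν₀ = -(e ^ 2 * c ^ 2) := by
    rw [← hν₀t]
    nth_rewrite 2 [hν₀]
    rw [map_sub, hnorm, sub_zero]
  have hec : 0 < e * c := mul_pos hη0 hc0
  refine ⟨(e * c)⁻¹ • ν₀, fun v => ?_, ?_, ?_, fun X hX => ?_⟩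
  · rw [map_smul, smul_apply, hnorm, smul_zero]
  · rw [map_smul, map_smul, smul_apply, hν₀ν₀, smul_eq_mul, smul_eq_mul]
    field_simp
  · rw [map_smul, smul_apply, hν₀t, smul_eq_mul]
    have : 0 < (e * c)⁻¹ * (e ^ 2 * c ^ 2) := by positivity
    linarith
  · rw [map_smul, hν₀, map_sub, hX, hBt, smul_eq_mul]
    field_simp
    ring

/-- The differential inequality satisfied by the time function of a spacelike hypersurface `F` whose
mean curvature is at least that of the slices, in coordinates. The sums over the orthonormal frame
`f` are the Laplacian of the time function, the square of the norm of its gradient, and its scalar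
product with the gradient of the warping function `η`. -/
lemma sum_hessian_time_nonneg [FiniteDimensional ℝ V] [FiniteDimensional ℝ V'] {m : ℕ} (hm : 0 < m)
    {F : V → ℝ × V'} {x : V} (hF : ContDiffAt ℝ 2 F x)
    (hη : ContDiffAt ℝ 1 η (F x).2) (hρ : ContDiffAt ℝ 1 ρ (F x).1) (hS : ContDiffAt ℝ 1 S (F x).2)
    (hη0 : 0 < η (F x).2) (hρ0 : 0 < ρ (F x).1) (hρ' : 0 ≤ deriv ρ (F x).1)
    (hsymm : ∀ a b, S (F x).2 a b = S (F x).2 b a) (hpos : ∀ a, a ≠ 0 → 0 < S (F x).2 a a)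
    {g : V → V →L[ℝ] V →L[ℝ] ℝ}
    (hg : g =ᶠ[𝓝 x] fun y => pullbackForm (warpedForm η ρ S (F y)) (fderiv ℝ F y))
    (hginv : (g x).IsInvertible) {f : Fin m → V} (hf : IsOrthonormalFrame (g x) f)
    (hspan : ∀ v, ∃ c : Fin m → ℝ, ∑ i, c i • f i = v)
    (hH : ∀ ν, (∀ v, warpedForm η ρ S (F x) ν (fderiv ℝ F x v) = 0) →
      warpedForm η ρ S (F x) ν ν = -1 → warpedForm η ρ S (F x) ν (1, 0) < 0 →
      deriv ρ (F x).1 / (η (F x).2 * ρ (F x).1) ≤ -warpedForm η ρ S (F x) ((m : ℝ)⁻¹ • ∑ i,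
        (fderiv ℝ (fderiv ℝ F) x (f i) (f i)
          + christoffel (warpedForm η ρ S) (F x) (fderiv ℝ F x (f i)) (fderiv ℝ F x (f i))
          - fderiv ℝ F x (christoffel g x (f i) (f i)))) ν) :
    0 ≤ ∑ i, (fderiv ℝ (fderiv ℝ fun y => (F y).1) x (f i) (f i)
          - fderiv ℝ (fun y => (F y).1) x (christoffel g x (f i) (f i)))
        + deriv ρ (F x).1 / ρ (F x).1 * ∑ i, fderiv ℝ (fun y => (F y).1) x (f i) ^ 2
        + 2 / η (F x).2 * ∑ i, fderiv ℝ (fun y => η (F y).2) x (f i)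
            * fderiv ℝ (fun y => (F y).1) x (f i) := by
  -- derivatives of the components of `F`
  have hD : ∀ᶠ y in 𝓝 x, DifferentiableAt ℝ F y := by
    filter_upwards [hF.eventually (by simp)] with y hy using hy.differentiableAt (by simp)
  have hτ : ∀ᶠ y in 𝓝 x, fderiv ℝ (fun y => (F y).1) y
      = (ContinuousLinearMap.fst ℝ ℝ V').comp (fderiv ℝ F y) := by
    filter_upwards [hD] with y hy using hy.hasFDerivAt.fst.fderiv
  have hτ1 : ∀ v, fderiv ℝ (fun y => (F y).1) x v = (fderiv ℝ F x v).1 := fun v => by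
    rw [hτ.self_of_nhds]; rfl
  have hτ2 : ∀ v w, fderiv ℝ (fderiv ℝ fun y => (F y).1) x v w
      = (fderiv ℝ (fderiv ℝ F) x v w).1 := fun v w => by
    have hDF : HasFDerivAt (fderiv ℝ F) (fderiv ℝ (fderiv ℝ F) x) x :=
      ((hF.fderiv_right (m := 1) (by norm_num)).differentiableAt (by simp)).hasFDerivAt
    have h1 := (hasFDerivAt_const (ContinuousLinearMap.fst ℝ ℝ V') x).clm_comp hDF
    have h2 : fderiv ℝ (fun y => (F y).1) =ᶠ[𝓝 x]
      fun y => (ContinuousLinearMap.fst ℝ ℝ V').comp (fderiv ℝ F y) := hτ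
    rw [h2.fderiv_eq, h1.fderiv]
    simp
  have hη1 : ∀ v, fderiv ℝ (fun y => η (F y).2) x v
      = fderiv ℝ η (F x).2 (fderiv ℝ F x v).2 := fun v => by
    have h1 := (hη.differentiableAt (by simp)).hasFDerivAt.comp x hD.self_of_nhds.hasFDerivAt.snd
    exact congrArg (fun L : V →L[ℝ] ℝ => L v) h1.fderiv
  simp only [hτ1, hτ2, hη1]
  have hgx := hg.eq_of_nhds
  have hf' : IsOrthonormalFrame (pullbackForm (warpedForm η ρ S (F x)) (fderiv ℝ F x)) f :=
    hgx ▸ hf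
  obtain ⟨ν, hν1, hν2, hν3, hν4⟩ := exists_warped_unit_normal hη0 hsymm hf' hspan
  have hH' := hH ν hν1 hν2 hν3
  -- the mean curvature vector is normal, so its product with `ν` is seen in its time component
  have hGauss := fun v z => apply_sndFDeriv_add_christoffel hF (hη.warpedForm hρ hS)
    (warpedForm_symm hsymm) (warpedForm_isInvertible hη0 hρ0 hpos) hg hginv v v z
  rw [hν4 _ fun v => by
    rw [map_smul, map_sum, smul_apply, sum_apply,
      Finset.sum_eq_zero fun i _ => hGauss (f i) v, smul_zero]] at hH'
  -- the frame vectors are unit vectors, which eliminates the fibre metric `S`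
  have hfi : ∀ i, ρ (F x).1 ^ 2 * S (F x).2 (fderiv ℝ F x (f i)).2 (fderiv ℝ F x (f i)).2
      = 1 + η (F x).2 ^ 2 * (fderiv ℝ F x (f i)).1 ^ 2 := fun i => by
    have h1 := hf' i i
    rw [pullbackForm_apply, warpedForm_apply, if_pos rfl] at h1
    linarith
  set e := η (F x).2
  set r := ρ (F x).1
  set r' := deriv ρ (F x).1
  set Q := ∑ i, (fderiv ℝ F x (f i)).1 ^ 2 with hQ
  set A := ∑ i, ((fderiv ℝ (fderiv ℝ F) x (f i) (f i)).1
    - (fderiv ℝ F x (christoffel g x (f i) (f i))).1) with hA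
  set Z := ∑ i, fderiv ℝ η (F x).2 (fderiv ℝ F x (f i)).2 * (fderiv ℝ F x (f i)).1 with hZ
  have hsum : (∑ i, (fderiv ℝ (fderiv ℝ F) x (f i) (f i)
          + christoffel (warpedForm η ρ S) (F x) (fderiv ℝ F x (f i)) (fderiv ℝ F x (f i))
          - fderiv ℝ F x (christoffel g x (f i) (f i)))).1
      = A + 2 / e * Z + r' / (r * e ^ 2) * (m + e ^ 2 * Q) := by
    have hmm : (m : ℝ) = ∑ i : Fin m, 1 := by simp
    rw [Prod.fst_sum, hmm, hQ, hA, hZ]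
    simp only [Finset.mul_sum, ← Finset.sum_add_distrib]
    refine Finset.sum_congr rfl fun i _ => ?_
    have hΓ : (christoffel (warpedForm η ρ S) (F x) (fderiv ℝ F x (f i)) (fderiv ℝ F x (f i))).1
        = (fderiv ℝ η (F x).2 (fderiv ℝ F x (f i)).2 * (fderiv ℝ F x (f i)).1
            + fderiv ℝ η (F x).2 (fderiv ℝ F x (f i)).2 * (fderiv ℝ F x (f i)).1) / e
          + r * r' * S (F x).2 (fderiv ℝ F x (f i)).2 (fderiv ℝ F x (f i)).2 / e ^ 2 :=
      christoffel_warpedForm_fst hη hρ hS hη0 hρ0 hpos _ _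
    rw [← hfi i, Prod.fst_sub, Prod.fst_add, hΓ]
    field_simp
    ring
  have hQ0 : 0 ≤ Q := Finset.sum_nonneg fun i _ => sq_nonneg _
  set c := Real.sqrt (1 + e ^ 2 * Q) with hc
  have hc1 : 1 ≤ c := Real.one_le_sqrt.2 (le_add_of_nonneg_right (by positivity))
  have hm' : (0 : ℝ) < m := Nat.cast_pos.2 hm
  rw [Prod.smul_fst, hsum, smul_eq_mul] at hH'
  have h1 : r' / (e * r) ≤ e / c * ((m : ℝ)⁻¹ * (A + 2 / e * Z
      + r' / (r * e ^ 2) * (m + e ^ 2 * Q))) := by linarith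
  have hk : 0 ≤ r' / (r * e ^ 2) := by positivity
  have h2 : r' / (r * e ^ 2) * (m * c) ≤ A + 2 / e * Z + r' / (r * e ^ 2) * (m + e ^ 2 * Q) := by
    have hpos' : 0 < m * c / e := by positivity
    have h3 := mul_le_mul_of_nonneg_left h1 hpos'.le
    calc r' / (r * e ^ 2) * (m * c) = m * c / e * (r' / (e * r)) := by field_simp
      _ ≤ _ := h3
      _ = _ := by field_simp
  -- here `ρ' ≥ 0` and `c ≥ 1` are used
  have h4 : r' / (r * e ^ 2) * m ≤ r' / (r * e ^ 2) * (m * c) := by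
    gcongr
    nlinarith
  have h5 : r' / (r * e ^ 2) * (m + e ^ 2 * Q) = r' / (r * e ^ 2) * m + r' / r * Q := by
    field_simp
  linarith

end Warped

/-! ### Fields of bilinear forms in charts -/

section Charts

variable {E : Type*} [NormedAddCommGroup E] [NormedSpace ℝ E] {H : Type*} [TopologicalSpace H]
  {J : ModelWithCorners ℝ E H} [J.Boundaryless] {N : Type*} [TopologicalSpace N] [ChartedSpace H N]
  {E' : Type*} [NormedAddCommGroup E'] [NormedSpace ℝ E'] {H' : Type*} [TopologicalSpace H']
  {J' : ModelWithCorners ℝ E' H'} [J'.Boundaryless] {N' : Type*} [TopologicalSpace N']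
  [ChartedSpace H' N']

lemma mdifferentiableAt_extChartAt_symm_of_boundaryless [IsManifold J 1 N] {p : N} {y : E}
    (hy : y ∈ (extChartAt J p).target) : MDifferentiableAt 𝓘(ℝ, E) J (extChartAt J p).symm y := by
  have h := mdifferentiableWithinAt_extChartAt_symm hy
  rwa [J.range_eq_univ, mdifferentiableWithinAt_univ] at h

lemma mfderiv_extChartAt_symm_self [IsManifold J 1 N] (p : N) :
    mfderiv 𝓘(ℝ, E) J (extChartAt J p).symm (extChartAt J p p) = ContinuousLinearMap.id ℝ E := by
  have h := mfderivWithin_range_extChartAt_symm (I := J) (x := p)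
  rwa [J.range_eq_univ, mfderivWithin_univ] at h

lemma mfderiv_extChartAt_symm_bijective [IsManifold J 1 N] {p : N} {y : E}
    (hy : y ∈ (extChartAt J p).target) :
    Function.Bijective (mfderiv 𝓘(ℝ, E) J (extChartAt J p).symm y) := by
  have h := isInvertible_mfderivWithin_extChartAt_symm hy
  rw [J.range_eq_univ, mfderivWithin_univ] at h
  exact h.bijective

/-- At the centre of a preferred chart, the derivative of the chart is the identity of the model
space, and `coordForm` is the form itself. -/
lemma coordForm_self [IsManifold J 1 N]
    (B : ∀ q : N, TangentSpace J q →L[ℝ] TangentSpace J q →L[ℝ] ℝ) (p : N) :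
    coordForm J B p (extChartAt J p p) = B p := by
  have h1 : coordForm J B p (extChartAt J p p)
      = pullbackForm (V := E) (W := E) (B ((extChartAt J p).symm (extChartAt J p p)))
        (ContinuousLinearMap.id ℝ E) := by
    rw [← mfderiv_extChartAt_symm_self (J := J) p]
    rfl
  rw [h1, extChartAt_to_inv]
  rfl

/-- In charts, the pullback of a field of bilinear forms by a map is its pullback by the coordinate
expression of the map. -/
lemma coordForm_pullback_eventuallyEq [IsManifold J 1 N] [IsManifold J' 1 N']
    (B : ∀ q : N', TangentSpace J' q →L[ℝ] TangentSpace J' q →L[ℝ] ℝ) {φ : N → N'}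
    (hφ : MDifferentiable J J' φ) {p p₁ : N} {p' : N'} (hp : p₁ ∈ (extChartAt J p).source)
    (hp' : φ p₁ ∈ (extChartAt J' p').source) :
    coordForm J (fun q => pullbackForm (V := E) (W := E') (B (φ q)) (mfderiv J J' φ q)) p
      =ᶠ[𝓝 (extChartAt J p p₁)] fun y =>
        pullbackForm (coordForm J' B p' ((extChartAt J' p' ∘ φ ∘ (extChartAt J p).symm) y))
          (fderiv ℝ (extChartAt J' p' ∘ φ ∘ (extChartAt J p).symm) y) := by
  have hmem : ∀ᶠ y in 𝓝 (extChartAt J p p₁), y ∈ (extChartAt J p).target ∧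
      φ ((extChartAt J p).symm y) ∈ (extChartAt J' p').source := by
    have h1 : (extChartAt J p).target ∈ 𝓝 (extChartAt J p p₁) :=
      (isOpen_extChartAt_target p).mem_nhds ((extChartAt J p).map_source hp)
    refine (eventually_mem_set.2 h1).and ?_
    have h2 : ContinuousAt (fun y => φ ((extChartAt J p).symm y)) (extChartAt J p p₁) :=
      hφ.continuous.continuousAt.comp (continuousAt_extChartAt_symm' hp)
    refine h2.eventually_mem ((isOpen_extChartAt_source p').mem_nhds ?_)
    rwa [(extChartAt J p).left_inv hp]
  filter_upwards [hmem, hmem.eventually_nhds] with y hy hy'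
  set F := extChartAt J' p' ∘ φ ∘ (extChartAt J p).symm with hF
  have hs := mdifferentiableAt_extChartAt_symm_of_boundaryless hy.1
  have hφs : MDifferentiableAt 𝓘(ℝ, E) J' (φ ∘ (extChartAt J p).symm) y :=
    MDifferentiableAt.comp y (hφ _) hs
  have hFd : MDifferentiableAt 𝓘(ℝ, E) 𝓘(ℝ, E') F y :=
    MDifferentiableAt.comp y (mdifferentiableAt_extChartAt (by simpa using hy.2)) hφs
  have hFt : F y ∈ (extChartAt J' p').target := (extChartAt J' p').map_source hy.2
  have hs' := mdifferentiableAt_extChartAt_symm_of_boundaryless hFt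
  have heq : (extChartAt J' p').symm ∘ F =ᶠ[𝓝 y] φ ∘ (extChartAt J p).symm := by
    filter_upwards [hy'] with z hz
    exact (extChartAt J' p').left_inv hz.2
  have hder : (mfderiv J J' φ ((extChartAt J p).symm y)).comp
      (mfderiv 𝓘(ℝ, E) J (extChartAt J p).symm y)
      = (mfderiv 𝓘(ℝ, E') J' (extChartAt J' p').symm (F y)).comp
        (mfderiv 𝓘(ℝ, E) 𝓘(ℝ, E') F y) := by
    rw [← mfderiv_comp y (hφ _) hs, ← mfderiv_comp y hs' hFd]
    exact heq.symm.mfderiv_eq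
  have hpt : φ ((extChartAt J p).symm y) = (extChartAt J' p').symm (F y) := heq.eq_of_nhds.symm
  have hl : coordForm J (fun q => pullbackForm (V := E) (W := E') (B (φ q)) (mfderiv J J' φ q)) p y
      = pullbackForm (V := E) (W := E') (B (φ ((extChartAt J p).symm y)))
        ((mfderiv J J' φ ((extChartAt J p).symm y)).comp
          (mfderiv 𝓘(ℝ, E) J (extChartAt J p).symm y)) := rfl
  have hr : pullbackForm (coordForm J' B p' (F y)) (fderiv ℝ F y)
      = pullbackForm (V := E) (W := E') (B ((extChartAt J' p').symm (F y)))
        ((mfderiv 𝓘(ℝ, E') J' (extChartAt J' p').symm (F y)).comp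
        (mfderiv 𝓘(ℝ, E) 𝓘(ℝ, E') F y)) := by
    rw [mfderiv_eq_fderiv]
    rfl
  have hB : ∀ {q q' : N'} {L L' : E →L[ℝ] E'}, q = q' → L = L' →
      pullbackForm (V := E) (W := E') (B q) L = pullbackForm (V := E) (W := E') (B q') L' := by
    rintro q _ L _ rfl rfl
    rfl
  exact hl.trans ((hB hpt hder).trans hr.symm)

/-- The expressions of a field of bilinear forms in two charts are related by pullback along the
change of coordinates. -/
lemma coordForm_change_eventuallyEq [IsManifold J 1 N]
    (B : ∀ q : N, TangentSpace J q →L[ℝ] TangentSpace J q →L[ℝ] ℝ) {p p' p₁ : N}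
    (hp : p₁ ∈ (extChartAt J p).source) (hp' : p₁ ∈ (extChartAt J p').source) :
    coordForm J B p =ᶠ[𝓝 (extChartAt J p p₁)] fun y =>
        pullbackForm (coordForm J B p' ((extChartAt J p' ∘ (extChartAt J p).symm) y))
          (fderiv ℝ (extChartAt J p' ∘ (extChartAt J p).symm) y) := by
  have h := coordForm_pullback_eventuallyEq (J := J) (J' := J) B (φ := id) mdifferentiable_id hp hp'
  simpa only [mfderiv_id] using! h

/-- A smooth Riemannian metric is smooth in charts: its values on the pushed forward coordinate
vector fields are smooth functions. -/
lemma coordForm_contDiffAt [FiniteDimensional ℝ E] [IsManifold J ∞ N]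
    (σ : ContMDiffRiemannianMetric J ∞ E (fun x : N => TangentSpace J x)) {p : N} {y : E}
    (hy : y ∈ (extChartAt J p).target) : ContDiffAt ℝ ∞ (coordForm J σ.inner p) y := by
  have : IsManifold J 1 N := IsManifold.of_le (n := ∞) (by simp)
  have hopen : IsOpen (extChartAt J p).target := isOpen_extChartAt_target p
  have hsec : ∀ v : E, ContMDiffOn 𝓘(ℝ, E) J.tangent ∞
      (fun z => (⟨(extChartAt J p).symm z, mfderiv 𝓘(ℝ, E) J (extChartAt J p).symm z v⟩ :
        TangentBundle J N)) (extChartAt J p).target := by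
    intro v
    have h1 := (contMDiffOn_extChartAt_symm (I := J) (n := ∞) p).contMDiffOn_tangentMapWithin
      (m := ∞) (by simp) hopen.uniqueMDiffOn
    have h2 : ContMDiff 𝓘(ℝ, E) 𝓘(ℝ, E).tangent ∞
        (fun z => (⟨z, v⟩ : TangentBundle 𝓘(ℝ, E) E)) :=
      contMDiff_vectorSpace_iff_contDiff.2 contDiff_const
    have h3 := h1.comp h2.contMDiffOn (s := (extChartAt J p).target) fun z hz => hz
    refine h3.congr fun z hz => ?_
    simp only [Function.comp_apply, tangentMapWithin]
    rw [mfderivWithin_of_isOpen hopen hz]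
  have hb : ContMDiffOn 𝓘(ℝ, E) J ∞ (extChartAt J p).symm (extChartAt J p).target :=
    contMDiffOn_extChartAt_symm p
  have hscal : ∀ v w : E, ContDiffOn ℝ ∞ (fun z => coordForm J σ.inner p z v w)
      (extChartAt J p).target := by
    intro v w
    rw [← contMDiffOn_iff_contDiffOn]
    intro z hz
    have : ContMDiffWithinAt 𝓘(ℝ, E) (J.prod 𝓘(ℝ)) ∞
        (fun z => TotalSpace.mk' ℝ (E := Bundle.Trivial N ℝ) ((extChartAt J p).symm z)
          (σ.inner ((extChartAt J p).symm z) (mfderiv 𝓘(ℝ, E) J (extChartAt J p).symm z v)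
            (mfderiv 𝓘(ℝ, E) J (extChartAt J p).symm z w))) (extChartAt J p).target z := by
      apply ContMDiffWithinAt.clm_bundle_apply₂ (F₁ := E) (F₂ := E)
      · exact ContMDiffAt.comp_contMDiffWithinAt z σ.contMDiff.contMDiffAt (hb z hz)
      · exact hsec v z hz
      · exact hsec w z hz
    simp only [contMDiffWithinAt_totalSpace] at this
    exact this.2
  refine ContDiffOn.contDiffAt ?_ (hopen.mem_nhds hy)
  rw [contDiffOn_clm_apply]
  intro v
  rw [contDiffOn_clm_apply]
  exact hscal v

end Charts

/-! ### The second fundamental form in coordinates -/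

section ChristoffelLinear

variable {V : Type*} [NormedAddCommGroup V] [NormedSpace ℝ V]

lemma christoffel_add_left (G : V → V →L[ℝ] V →L[ℝ] ℝ) (y v v' w : V) :
    christoffel G y (v + v') w = christoffel G y v w + christoffel G y v' w := by
  have h : koszulForm G y (v + v') w = koszulForm G y v w + koszulForm G y v' w := by
    ext z
    simp only [add_apply, koszulForm_apply, map_add]
    ring
  rw [christoffel, h, map_add]
  rfl

lemma christoffel_smul_left (G : V → V →L[ℝ] V →L[ℝ] ℝ) (y v w : V) (c : ℝ) :
    christoffel G y (c • v) w = c • christoffel G y v w := by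
  have h : koszulForm G y (c • v) w = c • koszulForm G y v w := by
    ext z
    simp only [smul_apply, koszulForm_apply, map_smul, smul_eq_mul]
    ring
  rw [christoffel, h, map_smul]
  rfl

lemma christoffel_add_right (G : V → V →L[ℝ] V →L[ℝ] ℝ) (y v w w' : V) :
    christoffel G y v (w + w') = christoffel G y v w + christoffel G y v w' := by
  have h : koszulForm G y v (w + w') = koszulForm G y v w + koszulForm G y v w' := by
    ext z
    simp only [add_apply, koszulForm_apply, map_add]
    ring
  rw [christoffel, h, map_add]
  rfl

lemma christoffel_smul_right (G : V → V →L[ℝ] V →L[ℝ] ℝ) (y v w : V) (c : ℝ) :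
    christoffel G y v (c • w) = c • christoffel G y v w := by
  have h : koszulForm G y v (c • w) = c • koszulForm G y v w := by
    ext z
    simp only [smul_apply, koszulForm_apply, map_smul, smul_eq_mul]
    ring
  rw [christoffel, h, map_smul]
  rfl

/-- The second fundamental form `D²F(v, w) + Γ̄(DF v, DF w) - DF Γ(v, w)` of a map `F` between
vector spaces with metrics `G` and `g`, at a point `x` with image `y`, as a bilinear map. -/
noncomputable def coordSecondFundamentalForm {W : Type*} [NormedAddCommGroup W] [NormedSpace ℝ W]
    (F : V → W) (G : W → W →L[ℝ] W →L[ℝ] ℝ) (g : V → V →L[ℝ] V →L[ℝ] ℝ) (x : V) (y : W) :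
    V →ₗ[ℝ] V →ₗ[ℝ] W :=
  LinearMap.mk₂ ℝ (fun v w => (fderiv ℝ (fderiv ℝ F) x v w
      + christoffel G y (fderiv ℝ F x v) (fderiv ℝ F x w)) - fderiv ℝ F x (christoffel g x v w))
    (fun v v' w => by
      simp only [map_add, christoffel_add_left, add_apply]
      abel)
    (fun c v w => by
      simp only [map_smul, christoffel_smul_left, smul_apply, smul_add, smul_sub])
    (fun v w w' => by
      simp only [map_add, christoffel_add_right]
      abel)
    (fun c v w => by
      simp only [map_smul, christoffel_smul_right, smul_add, smul_sub])

end ChristoffelLinear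

namespace DoublyWarpedProduct

variable {m : ℕ} {P : Type*} [TopologicalSpace P]
  [ChartedSpace (EuclideanSpace ℝ (Fin m)) P]

/-! ### The spacetime metric in charts -/

lemma extChartAt_stModel_apply (p p' : ℝ × P) :
    extChartAt (stModel m) p p' = (p'.1, extChartAt (𝓡 m) p.2 p'.2) := by
  rw [extChartAt_prod]
  simp [chartAt_self_eq]

lemma extChartAt_stModel_symm_apply (p : ℝ × P) (y : ℝ × EuclideanSpace ℝ (Fin m)) :
    (extChartAt (stModel m) p).symm y = (y.1, (extChartAt (𝓡 m) p.2).symm y.2) := by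
  rw [extChartAt_prod]
  simp [chartAt_self_eq]

lemma mem_extChartAt_stModel_target {p : ℝ × P} {y : ℝ × EuclideanSpace ℝ (Fin m)} :
    y ∈ (extChartAt (stModel m) p).target ↔ y.2 ∈ (extChartAt (𝓡 m) p.2).target := by
  rw [extChartAt_prod]
  simp [chartAt_self_eq]

lemma mem_extChartAt_stModel_source {p p' : ℝ × P} :
    p' ∈ (extChartAt (stModel m) p).source ↔ p'.2 ∈ (extChartAt (𝓡 m) p.2).source := by
  rw [extChartAt_prod]
  simp [chartAt_self_eq]

lemma dt_eq (p : ℝ × P) : dt p = ((1 : ℝ), (0 : EuclideanSpace ℝ (Fin m))) := by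
  rw [dt, mfderiv_prod_left]
  rfl

variable [IsManifold (𝓡 m) ∞ P] (D : DoublyWarpedProduct m P)

lemma mfderiv_extChartAt_stModel_symm {p : ℝ × P} {y : ℝ × EuclideanSpace ℝ (Fin m)}
    (hy : y ∈ (extChartAt (stModel m) p).target) (v : ℝ × EuclideanSpace ℝ (Fin m)) :
    mfderiv 𝓘(ℝ, ℝ × EuclideanSpace ℝ (Fin m)) (stModel m) (extChartAt (stModel m) p).symm y v
      = (v.1,
          mfderiv 𝓘(ℝ, EuclideanSpace ℝ (Fin m)) (𝓡 m) (extChartAt (𝓡 m) p.2).symm y.2 v.2) := by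
  have : IsManifold (𝓡 m) 1 P := IsManifold.of_le (n := ∞) (by simp)
  have hfun : ((extChartAt (stModel m) p).symm : ℝ × EuclideanSpace ℝ (Fin m) → ℝ × P)
      = fun z => (z.1, ((extChartAt (𝓡 m) p.2).symm ∘ Prod.snd) z) :=
    funext fun z => extChartAt_stModel_symm_apply p z
  have hs := mdifferentiableAt_extChartAt_symm_of_boundaryless
    (mem_extChartAt_stModel_target.1 hy)
  have h1 : MDifferentiableAt 𝓘(ℝ, ℝ × EuclideanSpace ℝ (Fin m)) 𝓘(ℝ, ℝ) Prod.fst y :=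
    differentiableAt_fst.mdifferentiableAt
  have h2 : MDifferentiableAt 𝓘(ℝ, ℝ × EuclideanSpace ℝ (Fin m)) 𝓘(ℝ, EuclideanSpace ℝ (Fin m))
      Prod.snd y := differentiableAt_snd.mdifferentiableAt
  rw [hfun, mfderiv_prodMk h1 (hs.comp y h2), mfderiv_comp y hs h2]
  simp only [mfderiv_eq_fderiv, fderiv_fst, fderiv_snd]
  rfl

/-- In charts, the spacetime metric is doubly warped in the sense of `warpedForm`. -/
lemma coordForm_metric {p : ℝ × P} {y : ℝ × EuclideanSpace ℝ (Fin m)}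
    (hy : y ∈ (extChartAt (stModel m) p).target) :
    coordForm (stModel m) D.metric p y
      = warpedForm (D.h ∘ (extChartAt (𝓡 m) p.2).symm) D.ρ
        (coordForm (𝓡 m) D.σ.inner p.2) y := by
  have hmet : ∀ {p p' : ℝ × P} {v w v' w' : ℝ × EuclideanSpace ℝ (Fin m)},
      p = p' → v = v' → w = w' → D.metric p v w
        = -(D.h p'.2 ^ 2) * (v'.1 * w'.1) + D.ρ p'.1 ^ 2 * D.σ.inner p'.2 v'.2 w'.2 := by
    rintro p _ v w _ _ rfl rfl rfl
    rw [metric, mfderiv_fst, mfderiv_snd]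
    rfl
  exact ContinuousLinearMap.ext fun v => ContinuousLinearMap.ext fun w =>
    hmet (extChartAt_stModel_symm_apply p y) (mfderiv_extChartAt_stModel_symm hy v)
      (mfderiv_extChartAt_stModel_symm hy w)

end DoublyWarpedProduct

/-! ### Smooth maps in charts -/

lemma contDiffAt_writtenInCharts {E : Type*} [NormedAddCommGroup E] [NormedSpace ℝ E]
    {H : Type*} [TopologicalSpace H] {J : ModelWithCorners ℝ E H} [J.Boundaryless]
    {N : Type*} [TopologicalSpace N] [ChartedSpace H N]
    {E' : Type*} [NormedAddCommGroup E'] [NormedSpace ℝ E'] {H' : Type*} [TopologicalSpace H']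
    {J' : ModelWithCorners ℝ E' H'} {N' : Type*} [TopologicalSpace N'] [ChartedSpace H' N']
    {n : WithTop ℕ∞} [IsManifold J n N] [IsManifold J' n N'] {φ : N → N'} (hφ : ContMDiff J J' n φ)
    {p p₁ : N} {p' : N'} (hp : p₁ ∈ (extChartAt J p).source)
    (hp' : φ p₁ ∈ (extChartAt J' p').source) :
    ContDiffAt ℝ n (extChartAt J' p' ∘ φ ∘ (extChartAt J p).symm) (extChartAt J p p₁) := by
  rw [← contMDiffAt_iff_contDiffAt]
  have h1 : ContMDiffAt 𝓘(ℝ, E) J n (extChartAt J p).symm (extChartAt J p p₁) :=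
    (contMDiffOn_extChartAt_symm p).contMDiffAt
      ((isOpen_extChartAt_target p).mem_nhds ((extChartAt J p).map_source hp))
  have h2 : ContMDiffAt 𝓘(ℝ, E) J' n (φ ∘ (extChartAt J p).symm) (extChartAt J p p₁) :=
    hφ.contMDiffAt.comp _ h1
  refine ContMDiffAt.comp _ (contMDiffAt_extChartAt' ?_) h2
  rw [Function.comp_apply, (extChartAt J p).left_inv hp]
  simpa using hp'

lemma contDiffAt_comp_extChartAt_symm {E : Type*} [NormedAddCommGroup E] [NormedSpace ℝ E]
    {H : Type*} [TopologicalSpace H] {J : ModelWithCorners ℝ E H} [J.Boundaryless]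
    {N : Type*} [TopologicalSpace N] [ChartedSpace H N]
    {E' : Type*} [NormedAddCommGroup E'] [NormedSpace ℝ E']
    {n : WithTop ℕ∞} [IsManifold J n N] {u : N → E'} (hu : ContMDiff J 𝓘(ℝ, E') n u)
    {p p₁ : N} (hp : p₁ ∈ (extChartAt J p).source) :
    ContDiffAt ℝ n (u ∘ (extChartAt J p).symm) (extChartAt J p p₁) := by
  have := contDiffAt_writtenInCharts hu (p' := u p₁) hp (mem_extChartAt_source _)
  simpa using! this

namespace DoublyWarpedProduct

variable {m : ℕ} {P : Type*} [TopologicalSpace P]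
  [ChartedSpace (EuclideanSpace ℝ (Fin m)) P] [IsManifold (𝓡 m) ∞ P]
  {D : DoublyWarpedProduct m P}
  {M : Type*} [TopologicalSpace M] [ChartedSpace (EuclideanSpace ℝ (Fin m)) M]
  {ψ : M → ℝ × P}

/-! ### Spacelike hypersurfaces in charts -/

lemma metric_symm (p : ℝ × P) (v w : TangentSpace (stModel m) p) :
    D.metric p v w = D.metric p w v := by
  have : IsManifold (𝓡 m) 1 P := IsManifold.of_le (n := ∞) (by simp)
  rw [← coordForm_self D.metric p, D.coordForm_metric (mem_extChartAt_target p)]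
  refine warpedForm_symm (fun a b => ?_) v w
  exact D.σ.symm _ _ _

lemma coordForm_inducedMetric_symm (q : M) (y v w : EuclideanSpace ℝ (Fin m)) :
    coordForm (𝓡 m) (D.inducedMetric ψ) q y v w = coordForm (𝓡 m) (D.inducedMetric ψ) q y w v :=
  metric_symm _ _ _

namespace IsSpacelikeHypersurface

lemma contDiffAt_warping (hψ : D.IsSpacelikeHypersurface ψ) {q q₁ : M} {p : ℝ × P}
    (hq : q₁ ∈ (extChartAt (𝓡 m) q).source) (hp : ψ q₁ ∈ (extChartAt (stModel m) p).source) :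
    ContDiffAt ℝ ∞ (D.h ∘ (extChartAt (𝓡 m) p.2).symm)
        ((extChartAt (stModel m) p ∘ ψ ∘ (extChartAt (𝓡 m) q).symm) (extChartAt (𝓡 m) q q₁)).2 ∧
      ContDiffAt ℝ ∞ D.ρ
        ((extChartAt (stModel m) p ∘ ψ ∘ (extChartAt (𝓡 m) q).symm) (extChartAt (𝓡 m) q q₁)).1 ∧
      ContDiffAt ℝ ∞ (coordForm (𝓡 m) D.σ.inner p.2)
        ((extChartAt (stModel m) p ∘ ψ ∘ (extChartAt (𝓡 m) q).symm)
          (extChartAt (𝓡 m) q q₁)).2 := by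
  have hp2 := mem_extChartAt_stModel_source.1 hp
  simp only [Function.comp_apply, (extChartAt (𝓡 m) q).left_inv hq, extChartAt_stModel_apply]
  exact ⟨contDiffAt_comp_extChartAt_symm D.contMDiff_h hp2,
    D.contDiffOn_ρ.contDiffAt (D.isOpen_I.mem_nhds (hψ.mem_I q₁)),
    coordForm_contDiffAt D.σ ((extChartAt (𝓡 m) p.2).map_source hp2)⟩

variable [IsManifold (𝓡 m) ∞ M]

lemma coordForm_pos (hψ : D.IsSpacelikeHypersurface ψ) {q : M} {y : EuclideanSpace ℝ (Fin m)}
    (hy : y ∈ (extChartAt (𝓡 m) q).target) (v : EuclideanSpace ℝ (Fin m)) (hv : v ≠ 0) :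
    0 < coordForm (𝓡 m) (D.inducedMetric ψ) q y v v := by
  have : IsManifold (𝓡 m) 1 M := IsManifold.of_le (n := ∞) (by simp)
  refine hψ.spacelike ((extChartAt (𝓡 m) q).symm y)
    (mfderiv 𝓘(ℝ, EuclideanSpace ℝ (Fin m)) (𝓡 m) (extChartAt (𝓡 m) q).symm y v) fun h => hv ?_
  exact (mfderiv_extChartAt_symm_bijective hy).1 (h.trans (map_zero _).symm)

lemma coordForm_isInvertible (hψ : D.IsSpacelikeHypersurface ψ) {q : M}
    {y : EuclideanSpace ℝ (Fin m)} (hy : y ∈ (extChartAt (𝓡 m) q).target) :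
    (coordForm (𝓡 m) (D.inducedMetric ψ) q y).IsInvertible :=
  isInvertible_of_nondegenerate fun v hv => by
    by_contra h
    exact (hψ.coordForm_pos hy v h).ne' (hv v)

/-- In charts, the metric induced by `ψ` is the pullback of a doubly warped metric by the coordinate
expression of `ψ`. -/
lemma coordForm_inducedMetric_eventuallyEq (hψ : D.IsSpacelikeHypersurface ψ) {q q₁ : M} {p : ℝ × P}
    (hq : q₁ ∈ (extChartAt (𝓡 m) q).source) (hp : ψ q₁ ∈ (extChartAt (stModel m) p).source) :
    coordForm (𝓡 m) (D.inducedMetric ψ) q =ᶠ[𝓝 (extChartAt (𝓡 m) q q₁)] fun y =>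
      pullbackForm (warpedForm (D.h ∘ (extChartAt (𝓡 m) p.2).symm) D.ρ
          (coordForm (𝓡 m) D.σ.inner p.2)
          ((extChartAt (stModel m) p ∘ ψ ∘ (extChartAt (𝓡 m) q).symm) y))
        (fderiv ℝ (extChartAt (stModel m) p ∘ ψ ∘ (extChartAt (𝓡 m) q).symm) y) := by
  have h1 : IsManifold (𝓡 m) 1 M := IsManifold.of_le (n := ∞) (by simp)
  have h2 : IsManifold (stModel m) 1 (ℝ × P) := IsManifold.of_le (n := ∞) (by simp)
  have h3 := coordForm_pullback_eventuallyEq D.metric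
    (hψ.contMDiff.mdifferentiable (by simp)) hq hp
  have h4 : ∀ᶠ y in 𝓝 (extChartAt (𝓡 m) q q₁),
      (extChartAt (stModel m) p ∘ ψ ∘ (extChartAt (𝓡 m) q).symm) y
        ∈ (extChartAt (stModel m) p).target := by
    refine (contDiffAt_writtenInCharts hψ.contMDiff hq hp).continuousAt.eventually_mem
      ((isOpen_extChartAt_target p).mem_nhds ?_)
    simp only [Function.comp_apply, (extChartAt (𝓡 m) q).left_inv hq]
    exact (extChartAt (stModel m) p).map_source hp
  filter_upwards [h3, h4] with y hy hy'
  rw [← D.coordForm_metric hy']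
  exact hy

lemma coordForm_inducedMetric_contDiffAt (hψ : D.IsSpacelikeHypersurface ψ) {q q₁ : M}
    (hq : q₁ ∈ (extChartAt (𝓡 m) q).source) :
    ContDiffAt ℝ 1 (coordForm (𝓡 m) (D.inducedMetric ψ) q) (extChartAt (𝓡 m) q q₁) := by
  have hp := mem_extChartAt_source (I := stModel m) (ψ q₁)
  refine ContDiffAt.congr_of_eventuallyEq ?_ (hψ.coordForm_inducedMetric_eventuallyEq hq hp)
  have hF := contDiffAt_writtenInCharts hψ.contMDiff hq hp
  obtain ⟨h1, h2, h3⟩ := hψ.contDiffAt_warping hq hp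
  refine ContDiffAt.pullbackForm ?_
    ((hF.of_le (m := 2) (ENat.LEInfty.out)).fderiv_right (by norm_num))
  exact ((h1.warpedForm h2 h3).comp _ hF).of_le (by norm_num)

end IsSpacelikeHypersurface

end DoublyWarpedProduct

namespace DoublyWarpedProduct

variable {m : ℕ} {P : Type*} [TopologicalSpace P]
  [ChartedSpace (EuclideanSpace ℝ (Fin m)) P] [IsManifold (𝓡 m) ∞ P]
  {D : DoublyWarpedProduct m P}
  {M : Type*} [TopologicalSpace M] [ChartedSpace (EuclideanSpace ℝ (Fin m)) M]
  {ψ : M → ℝ × P}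

/-! ### The differential inequality for the time function -/

/-- The mean curvature vector as an average over an orthonormal frame. -/
lemma meanCurvatureVector_eq_sum_frame (q : M) {f : Fin m → EuclideanSpace ℝ (Fin m)}
    (hf : IsOrthonormalFrame (V := EuclideanSpace ℝ (Fin m)) (D.inducedMetric ψ q) f) :
    D.meanCurvatureVector ψ q
      = (m : ℝ)⁻¹ • ∑ i, D.secondFundamentalForm ψ q (f i) (f i) := by
  -- the second fundamental form of `ψ` at `q`, bundled as a bilinear map
  let X := coordSecondFundamentalForm (writtenInExtChartAt (𝓡 m) (stModel m) q ψ)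
    (coordForm (stModel m) D.metric (ψ q)) (coordForm (𝓡 m) (D.inducedMetric ψ) q)
    (extChartAt (𝓡 m) q q) (extChartAt (stModel m) (ψ q) (ψ q))
  have hspan : ∀ v : EuclideanSpace ℝ (Fin m), ∃ c : Fin m → ℝ,
      ∑ i, c i • EuclideanSpace.single i (1 : ℝ) = v := fun v =>
    ⟨v, by simpa using (EuclideanSpace.basisFun (Fin m) ℝ).sum_repr v⟩
  have h := sum_inv_gram_smul_eq_sum_frame hf hspan X
  exact congrArg (fun u => (m : ℝ)⁻¹ • u) h

lemma mfderiv_eq_fderiv_writtenInCharts {m' : ℕ} {Q : Type*} [TopologicalSpace Q]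
    [ChartedSpace (EuclideanSpace ℝ (Fin m')) Q] {q : M} {φ : M → ℝ × Q}
    (hφ : MDifferentiableAt (𝓡 m) (stModel m') φ q) :
    mfderiv (𝓡 m) (stModel m') φ q
      = fderiv ℝ (extChartAt (stModel m') (φ q) ∘ φ ∘ (extChartAt (𝓡 m) q).symm)
        (extChartAt (𝓡 m) q q) := by
  rw [hφ.mfderiv]
  rw [ModelWithCorners.range_eq_univ, fderivWithin_univ]
  rfl

/-- The differential inequality for the time function `τ` of `ψ`, at a point `q` and in the
preferred chart around `q`. -/
lemma IsSpacelikeHypersurface.sum_hessian_time_nonneg_self [IsManifold (𝓡 m) ∞ M] (hm : 0 < m)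
    (hψ : D.IsSpacelikeHypersurface ψ) (hρ : ∀ t ∈ D.I, 0 ≤ deriv D.ρ t) (q : M)
    (hH : ∀ ν : TangentSpace (stModel m) (ψ q), D.IsFutureUnitNormal ψ q ν →
      D.sliceMeanCurvature (ψ q) ≤ D.meanCurvature ψ q ν)
    {f : Fin m → EuclideanSpace ℝ (Fin m)}
    (hf : IsOrthonormalFrame
      (coordForm (𝓡 m) (D.inducedMetric ψ) q (extChartAt (𝓡 m) q q)) f) :
    0 ≤ ∑ i, (fderiv ℝ (fderiv ℝ ((fun q => (ψ q).1) ∘ (extChartAt (𝓡 m) q).symm))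
            (extChartAt (𝓡 m) q q) (f i) (f i)
          - fderiv ℝ ((fun q => (ψ q).1) ∘ (extChartAt (𝓡 m) q).symm) (extChartAt (𝓡 m) q q)
            (christoffel (coordForm (𝓡 m) (D.inducedMetric ψ) q) (extChartAt (𝓡 m) q q)
              (f i) (f i)))
        + deriv D.ρ (ψ q).1 / D.ρ (ψ q).1 *
          ∑ i, fderiv ℝ ((fun q => (ψ q).1) ∘ (extChartAt (𝓡 m) q).symm)
            (extChartAt (𝓡 m) q q) (f i) ^ 2
        + 2 / D.h (ψ q).2 *
          ∑ i, fderiv ℝ ((fun q => D.h (ψ q).2) ∘ (extChartAt (𝓡 m) q).symm)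
              (extChartAt (𝓡 m) q q) (f i)
            * fderiv ℝ ((fun q => (ψ q).1) ∘ (extChartAt (𝓡 m) q).symm)
              (extChartAt (𝓡 m) q q) (f i) := by
  have hM1 : IsManifold (𝓡 m) 1 M := IsManifold.of_le (n := ∞) (by simp)
  have hP1 : IsManifold (stModel m) 1 (ℝ × P) := IsManifold.of_le (n := ∞) (by simp)
  have hq := mem_extChartAt_source (I := 𝓡 m) q
  have hp := mem_extChartAt_source (I := stModel m) (ψ q)
  have hq' := mem_extChartAt_target (I := 𝓡 m) q
  have hF := contDiffAt_writtenInCharts hψ.contMDiff hq hp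
  obtain ⟨h1, h2, h3⟩ := hψ.contDiffAt_warping hq hp
  have hg := hψ.coordForm_inducedMetric_eventuallyEq hq hp
  have hder := mfderiv_eq_fderiv_writtenInCharts (hψ.contMDiff.mdifferentiable (by simp) q)
  have hFdef : writtenInExtChartAt (𝓡 m) (stModel m) q ψ
    = extChartAt (stModel m) (ψ q) ∘ ψ ∘ (extChartAt (𝓡 m) q).symm := rfl
  set F := extChartAt (stModel m) (ψ q) ∘ ψ ∘ (extChartAt (𝓡 m) q).symm with hFF
  set x := extChartAt (𝓡 m) q q with hx
  set η := D.h ∘ (extChartAt (𝓡 m) (ψ q).2).symm with hη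
  set S := coordForm (𝓡 m) D.σ.inner (ψ q).2 with hS
  have hFx : F x = extChartAt (stModel m) (ψ q) (ψ q) := by
    simp only [hFF, Function.comp_apply, hx, (extChartAt (𝓡 m) q).left_inv hq]
  have hFx' : F x = ((ψ q).1, extChartAt (𝓡 m) (ψ q).2 (ψ q).2) := by
    rw [hFx, extChartAt_stModel_apply]
  have hηx : η (F x).2 = D.h (ψ q).2 := by
    rw [hFx', hη, Function.comp_apply, extChartAt_to_inv]
  have hρx : (F x).1 = (ψ q).1 := by rw [hFx']
  have hFtarget : F x ∈ (extChartAt (stModel m) (ψ q)).target := hFx ▸ mem_extChartAt_target _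
  have hτ : (fun q => (ψ q).1) ∘ (extChartAt (𝓡 m) q).symm = fun y => (F y).1 := by
    funext y
    simp only [hFF, Function.comp_apply, extChartAt_stModel_apply]
  have hk : (fun q => D.h (ψ q).2) ∘ (extChartAt (𝓡 m) q).symm =ᶠ[𝓝 x]
      fun y => η (F y).2 := by
    have hev : ∀ᶠ y in 𝓝 x, ψ ((extChartAt (𝓡 m) q).symm y)
        ∈ (extChartAt (stModel m) (ψ q)).source := by
      have hc : ContinuousAt (fun y => ψ ((extChartAt (𝓡 m) q).symm y)) x :=
        hψ.contMDiff.continuous.continuousAt.comp (continuousAt_extChartAt_symm q)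
      refine hc.eventually_mem ((isOpen_extChartAt_source (ψ q)).mem_nhds ?_)
      rwa [hx, extChartAt_to_inv]
    filter_upwards [hev] with y hy
    simp only [hFF, hη, Function.comp_apply, extChartAt_stModel_apply]
    rw [(extChartAt (𝓡 m) (ψ q).2).left_inv (mem_extChartAt_stModel_source.1 hy)]
  have hmet : D.metric (ψ q) = warpedForm η D.ρ S (F x) := by
    rw [← D.coordForm_metric hFtarget, hFx, coordForm_self]
  have hmetE : coordForm (stModel m) D.metric (ψ q) =ᶠ[𝓝 (F x)] warpedForm η D.ρ S := by
    filter_upwards [(isOpen_extChartAt_target (I := stModel m) (ψ q)).mem_nhds hFtarget] with y hy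
    exact D.coordForm_metric hy
  have hfind : IsOrthonormalFrame (V := EuclideanSpace ℝ (Fin m)) (D.inducedMetric ψ q) f := by
    rw [hx, coordForm_self] at hf
    exact hf
  have hIm := hψ.mem_I q
  have key := sum_hessian_time_nonneg (η := η) (ρ := D.ρ) (S := S) (F := F) (x := x) hm
    (hF.of_le (ENat.LEInfty.out)) (h1.of_le (by simp)) (h2.of_le (by simp)) (h3.of_le (by simp))
    (hηx ▸ D.h_pos _) (hρx ▸ D.ρ_pos _ hIm) (hρx ▸ hρ _ hIm) (fun a b => D.σ.symm _ _ _) ?_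
    hg (hψ.coordForm_isInvertible hq') hf (hf.exists_sum_eq (by simp)) ?_
  · rw [hτ, hk.fderiv_eq, ← hηx, ← hρx]
    exact key
  · intro a ha
    have hP2 : IsManifold (𝓡 m) 1 P := IsManifold.of_le (n := ∞) (by simp)
    refine D.σ.pos ((extChartAt (𝓡 m) (ψ q).2).symm (F x).2)
      (mfderiv 𝓘(ℝ, EuclideanSpace ℝ (Fin m)) (𝓡 m) (extChartAt (𝓡 m) (ψ q).2).symm (F x).2 a)
      fun h => ha ?_
    exact (mfderiv_extChartAt_symm_bijective (mem_extChartAt_stModel_target.1 hFtarget)).1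
      (h.trans (map_zero _).symm)
  · intro ν hν1 hν2 hν3
    have hν : D.IsFutureUnitNormal ψ q ν := by
      refine ⟨fun v => ?_, ?_, ?_⟩
      · rw [hmet, hder]
        exact hν1 v
      · rw [hmet]
        exact hν2
      · rw [hmet, dt_eq]
        exact hν3
    have h := hH ν hν
    change D.sliceMeanCurvature (ψ q) ≤ -D.metric (ψ q) (D.meanCurvatureVector ψ q) ν at h
    have hII : ∀ i, D.secondFundamentalForm ψ q (f i) (f i)
        = fderiv ℝ (fderiv ℝ F) x (f i) (f i)
          + christoffel (warpedForm η D.ρ S) (F x) (fderiv ℝ F x (f i)) (fderiv ℝ F x (f i))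
          - fderiv ℝ F x (christoffel (coordForm (𝓡 m) (D.inducedMetric ψ) q) x (f i) (f i)) := by
      intro i
      rw [← christoffel_congr hmetE, hFx]
      rfl
    rw [meanCurvatureVector_eq_sum_frame q hfind, sliceMeanCurvature, hmet] at h
    simp only [hII] at h
    rw [hηx, hρx]
    exact h

end DoublyWarpedProduct

namespace DoublyWarpedProduct

variable {m : ℕ} {P : Type*} [TopologicalSpace P]
  [ChartedSpace (EuclideanSpace ℝ (Fin m)) P] [IsManifold (𝓡 m) ∞ P]
  {D : DoublyWarpedProduct m P}
  {M : Type*} [TopologicalSpace M] [ChartedSpace (EuclideanSpace ℝ (Fin m)) M]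
  {ψ : M → ℝ × P}

lemma IsSpacelikeHypersurface.contMDiff_time (hψ : D.IsSpacelikeHypersurface ψ) :
    ContMDiff (𝓡 m) 𝓘(ℝ, ℝ) ∞ fun q => (ψ q).1 :=
  contMDiff_fst.comp hψ.contMDiff

lemma IsSpacelikeHypersurface.contMDiff_warping (hψ : D.IsSpacelikeHypersurface ψ) :
    ContMDiff (𝓡 m) 𝓘(ℝ, ℝ) ∞ fun q => D.h (ψ q).2 :=
  D.contMDiff_h.comp (contMDiff_snd.comp hψ.contMDiff)

variable [IsManifold (𝓡 m) ∞ M]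

/-- The differential inequality for the time function `τ` of `ψ`, in an arbitrary preferred
chart: the point `q` need not be the centre `q₀` of the chart. The frame is carried over from the
chart around `q` by the change of coordinates `κ`. -/
lemma IsSpacelikeHypersurface.exists_frame_sum_hessian_time_nonneg (hm : 0 < m)
    (hψ : D.IsSpacelikeHypersurface ψ) (hρ : ∀ t ∈ D.I, 0 ≤ deriv D.ρ t) {q₀ q : M}
    (hq : q ∈ (extChartAt (𝓡 m) q₀).source)
    (hH : ∀ ν : TangentSpace (stModel m) (ψ q), D.IsFutureUnitNormal ψ q ν →
      D.sliceMeanCurvature (ψ q) ≤ D.meanCurvature ψ q ν) :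
    ∃ f : Fin m → EuclideanSpace ℝ (Fin m),
      IsOrthonormalFrame (coordForm (𝓡 m) (D.inducedMetric ψ) q₀ (extChartAt (𝓡 m) q₀ q)) f ∧
      0 ≤ ∑ i, (fderiv ℝ (fderiv ℝ ((fun q => (ψ q).1) ∘ (extChartAt (𝓡 m) q₀).symm))
            (extChartAt (𝓡 m) q₀ q) (f i) (f i)
          - fderiv ℝ ((fun q => (ψ q).1) ∘ (extChartAt (𝓡 m) q₀).symm) (extChartAt (𝓡 m) q₀ q)
            (christoffel (coordForm (𝓡 m) (D.inducedMetric ψ) q₀) (extChartAt (𝓡 m) q₀ q)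
              (f i) (f i)))
        + deriv D.ρ (ψ q).1 / D.ρ (ψ q).1 *
          ∑ i, fderiv ℝ ((fun q => (ψ q).1) ∘ (extChartAt (𝓡 m) q₀).symm)
            (extChartAt (𝓡 m) q₀ q) (f i) ^ 2
        + 2 / D.h (ψ q).2 *
          ∑ i, fderiv ℝ ((fun q => D.h (ψ q).2) ∘ (extChartAt (𝓡 m) q₀).symm)
              (extChartAt (𝓡 m) q₀ q) (f i)
            * fderiv ℝ ((fun q => (ψ q).1) ∘ (extChartAt (𝓡 m) q₀).symm)
              (extChartAt (𝓡 m) q₀ q) (f i) := by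
  have hM1 : IsManifold (𝓡 m) 1 M := IsManifold.of_le (n := ∞) (by simp)
  have hqq := mem_extChartAt_source (I := 𝓡 m) q
  have hqt := mem_extChartAt_target (I := 𝓡 m) q
  have hqt₀ := (extChartAt (𝓡 m) q₀).map_source hq
  obtain ⟨f, hf⟩ := exists_isOrthonormalFrame (m := m)
    (coordForm_inducedMetric_symm q (extChartAt (𝓡 m) q q)) (hψ.coordForm_pos hqt) (by simp)
  have hineq := hψ.sum_hessian_time_nonneg_self hm hρ q hH hf
  have hκ : ContDiffAt ℝ ∞ (extChartAt (𝓡 m) q₀ ∘ (extChartAt (𝓡 m) q).symm)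
      (extChartAt (𝓡 m) q q) := contDiffAt_writtenInCharts contMDiff_id hqq hq
  have hg := coordForm_change_eventuallyEq (J := 𝓡 m) (D.inducedMetric ψ) hqq hq
  have hfun : ∀ u : M → ℝ, u ∘ (extChartAt (𝓡 m) q).symm =ᶠ[𝓝 (extChartAt (𝓡 m) q q)]
      (u ∘ (extChartAt (𝓡 m) q₀).symm) ∘ (extChartAt (𝓡 m) q₀ ∘ (extChartAt (𝓡 m) q).symm) := by
    intro u
    have h1 : ∀ᶠ y in 𝓝 (extChartAt (𝓡 m) q q),
        (extChartAt (𝓡 m) q).symm y ∈ (extChartAt (𝓡 m) q₀).source := by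
      refine (continuousAt_extChartAt_symm q).eventually_mem
        ((isOpen_extChartAt_source q₀).mem_nhds ?_)
      rwa [extChartAt_to_inv]
    filter_upwards [h1] with y hy
    simp only [Function.comp_apply, (extChartAt (𝓡 m) q₀).left_inv hy]
  set κ := extChartAt (𝓡 m) q₀ ∘ (extChartAt (𝓡 m) q).symm with hκdef
  set x := extChartAt (𝓡 m) q q with hx
  have hκx : κ x = extChartAt (𝓡 m) q₀ q := by
    rw [hκdef, Function.comp_apply, hx, extChartAt_to_inv]
  have hκ1 : DifferentiableAt ℝ κ x := hκ.differentiableAt (by simp)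
  have hτ : ContDiffAt ℝ ∞ ((fun q => (ψ q).1) ∘ (extChartAt (𝓡 m) q₀).symm) (κ x) :=
    hκx ▸ contDiffAt_comp_extChartAt_symm hψ.contMDiff_time hq
  have hk : ContDiffAt ℝ ∞ ((fun q => D.h (ψ q).2) ∘ (extChartAt (𝓡 m) q₀).symm) (κ x) :=
    hκx ▸ contDiffAt_comp_extChartAt_symm hψ.contMDiff_warping hq
  have hgx : coordForm (𝓡 m) (D.inducedMetric ψ) q x
      = pullbackForm (coordForm (𝓡 m) (D.inducedMetric ψ) q₀ (κ x)) (fderiv ℝ κ x) :=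
    hg.eq_of_nhds
  have hsurj : Function.Surjective (fderiv ℝ κ x) := by
    refine (LinearMap.injective_iff_surjective
      (f := (fderiv ℝ κ x : EuclideanSpace ℝ (Fin m) →ₗ[ℝ] EuclideanSpace ℝ (Fin m)))).1 ?_
    rw [injective_iff_map_eq_zero]
    intro v hv
    by_contra h
    have h1 := hψ.coordForm_pos hqt v h
    rw [hgx, pullbackForm_apply] at h1
    rw [show fderiv ℝ κ x v = 0 from hv] at h1
    simp at h1
  have hfd : ∀ {u : M → ℝ}, ContDiffAt ℝ ∞ (u ∘ (extChartAt (𝓡 m) q₀).symm) (κ x) → ∀ v,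
      fderiv ℝ (u ∘ (extChartAt (𝓡 m) q).symm) x v
        = fderiv ℝ (u ∘ (extChartAt (𝓡 m) q₀).symm) (κ x) (fderiv ℝ κ x v) := by
    intro u hu v
    rw [(hfun u).fderiv_eq, fderiv_comp x (hu.differentiableAt (by simp)) hκ1]
    rfl
  have hhess := fun v => hessian_comp (hκ.of_le ENat.LEInfty.out)
    (hκx ▸ hψ.coordForm_inducedMetric_contDiffAt hq) (coordForm_inducedMetric_symm q₀ (κ x))
    (hψ.coordForm_pos (hκx ▸ hqt₀)) hsurj hg (hψ.coordForm_isInvertible hqt)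
    (hτ.of_le ENat.LEInfty.out) (hfun _) v v
  refine ⟨fun i => fderiv ℝ κ x (f i), ?_, ?_⟩
  · rw [hgx] at hf
    rw [← hκx]
    exact hf.map
  · simp only [hhess] at hineq
    simp only [hfd hτ, hfd hk] at hineq
    rw [← hκx]
    exact hineq

/-- Local rigidity: the set where the time function attains its maximum is open. -/
lemma IsSpacelikeHypersurface.eventually_time_eq_of_isMax (hm : 0 < m)
    (hψ : D.IsSpacelikeHypersurface ψ) (hρ : ∀ t ∈ D.I, 0 ≤ deriv D.ρ t)
    (hH : ∀ (q : M) (ν : TangentSpace (stModel m) (ψ q)), D.IsFutureUnitNormal ψ q ν →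
      D.sliceMeanCurvature (ψ q) ≤ D.meanCurvature ψ q ν)
    {q₀ : M} (hmax : ∀ q, (ψ q).1 ≤ (ψ q₀).1) : ∀ᶠ q in 𝓝 q₀, (ψ q).1 = (ψ q₀).1 := by
  have hM1 : IsManifold (𝓡 m) 1 M := IsManifold.of_le (n := ∞) (by simp)
  have hq₀ := mem_extChartAt_source (I := 𝓡 m) q₀
  have hsmooth : ∀ y ∈ (extChartAt (𝓡 m) q₀).target,
      ContDiffAt ℝ ∞ ((fun q => (ψ q).1) ∘ (extChartAt (𝓡 m) q₀).symm) y ∧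
      ContDiffAt ℝ ∞ ((fun q => D.h (ψ q).2) ∘ (extChartAt (𝓡 m) q₀).symm) y := by
    intro y hy
    have h1 := (extChartAt (𝓡 m) q₀).map_target hy
    rw [← (extChartAt (𝓡 m) q₀).right_inv hy]
    exact ⟨contDiffAt_comp_extChartAt_symm hψ.contMDiff_time h1,
      contDiffAt_comp_extChartAt_symm hψ.contMDiff_warping h1⟩
  have hexists : ∀ y ∈ (extChartAt (𝓡 m) q₀).target, _ := fun y hy =>
    hψ.exists_frame_sum_hessian_time_nonneg hm hρ ((extChartAt (𝓡 m) q₀).map_target hy)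
      (hH ((extChartAt (𝓡 m) q₀).symm y))
  set u := (fun q => (ψ q).1) ∘ (extChartAt (𝓡 m) q₀).symm with hu
  set k := (fun q => D.h (ψ q).2) ∘ (extChartAt (𝓡 m) q₀).symm with hk
  set g := coordForm (𝓡 m) (D.inducedMetric ψ) q₀ with hg
  set x₀ := extChartAt (𝓡 m) q₀ q₀ with hx₀
  have hx₀t : x₀ ∈ (extChartAt (𝓡 m) q₀).target := mem_extChartAt_target q₀
  have htarget : (extChartAt (𝓡 m) q₀).target ∈ 𝓝 x₀ :=
    (isOpen_extChartAt_target q₀).mem_nhds hx₀t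
  obtain ⟨lam, Lam, C, hlam, hLam, hC, hbounds⟩ := exists_eventually_metric_bounds
    (hψ.coordForm_inducedMetric_contDiffAt hq₀) (hψ.coordForm_pos hx₀t)
  have hux₀ : u x₀ = (ψ q₀).1 := by rw [hu, Function.comp_apply, extChartAt_to_inv]
  -- local bounds for the coefficients of the gradient terms
  have hDu : ∀ᶠ y in 𝓝 x₀, ‖fderiv ℝ u y‖ < ‖fderiv ℝ u x₀‖ + 1 :=
    ((hsmooth x₀ hx₀t).1.fderiv_right (m := 0) (by simp)).continuousAt.norm.eventually_lt_const
      (lt_add_one _)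
  obtain ⟨A, hA⟩ : ∃ A, ∀ᶠ y in 𝓝 x₀, deriv D.ρ (u y) / D.ρ (u y) < A := by
    have hI : u x₀ ∈ D.I := hux₀ ▸ hψ.mem_I q₀
    have hρc : ContDiffAt ℝ ∞ D.ρ (u x₀) := D.contDiffOn_ρ.contDiffAt (D.isOpen_I.mem_nhds hI)
    have hderiv : ContinuousAt (deriv D.ρ) (u x₀) :=
      (hρc.fderiv_right (m := 0) (by simp)).continuousAt.clm_apply continuousAt_const
    have huc : ContinuousAt u x₀ := (hsmooth x₀ hx₀t).1.continuousAt
    have h1 : ContinuousAt (fun y => deriv D.ρ (u y) / D.ρ (u y)) x₀ :=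
      (hderiv.comp huc).div (hρc.continuousAt.comp huc) (D.ρ_pos _ hI).ne'
    exact ⟨_, h1.eventually_lt_const (lt_add_one _)⟩
  obtain ⟨B, hB⟩ : ∃ B, ∀ᶠ y in 𝓝 x₀, 2 / k y * ‖fderiv ℝ k y‖ < B := by
    have hkc := (hsmooth x₀ hx₀t).2
    have h1 : ContinuousAt (fun y => 2 / k y * ‖fderiv ℝ k y‖) x₀ :=
      (continuousAt_const.div hkc.continuousAt (D.h_pos _).ne').mul
        (hkc.fderiv_right (m := 0) (by simp)).continuousAt.norm
    exact ⟨_, h1.eventually_lt_const (lt_add_one _)⟩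
  obtain ⟨U, hUsub, hUopen, hxU⟩ := _root_.mem_nhds_iff.1
    (inter_mem htarget (hbounds.and (hDu.and (hA.and hB))))
  have hloc : ∀ᶠ y in 𝓝 x₀, u y = (ψ q₀).1 := by
    refine eventually_eq_of_isMax_of_elliptic (ι := Fin m) hUopen (lam := Lam⁻¹)
      (Lam := m * lam⁻¹)
      (C := (C + A * (‖fderiv ℝ u x₀‖ + 1) + B) * (m * lam⁻¹))
      (fun y hy => (hsmooth y (hUsub hy).1).1.of_le ENat.LEInfty.out) (inv_pos.2 hLam) ?_
      (fun y _ => hmax _) hxU hux₀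
    intro y hy
    obtain ⟨hyt, ⟨hb1, hb2, hb3⟩, hDuy, hAy, hBy⟩ := hUsub hy
    obtain ⟨f, hf, hineq⟩ := hexists y hyt
    rw [(extChartAt (𝓡 m) q₀).right_inv hyt] at hf hineq
    refine ⟨f, fun z => hf.norm_sq_le_sum_inner_sq hLam hb2 (by simp) z, ?_, ?_⟩
    · simpa using hf.sum_norm_sq_le hlam hb1
    have hT := hf.sum_norm_sq_le hlam hb1
    rw [Fintype.card_fin] at hT
    set T := ∑ i, ‖f i‖ ^ 2 with hTdef
    set n := ‖fderiv ℝ u y‖ with hn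
    set a := deriv D.ρ (u y) / D.ρ (u y) with ha
    set b := 2 / k y with hb
    have hI : u y ∈ D.I := hψ.mem_I _
    have ha0 : 0 ≤ a := div_nonneg (hρ _ hI) (D.ρ_pos _ hI).le
    have hb0 : 0 ≤ b := div_nonneg zero_le_two (D.h_pos _).le
    have hn0 : 0 ≤ n := norm_nonneg _
    have hT0 : 0 ≤ T := Finset.sum_nonneg fun i _ => sq_nonneg _
    have hDuf : ∀ i, |fderiv ℝ u y (f i)| ≤ n * ‖f i‖ := fun i => (fderiv ℝ u y).le_opNorm _
    have e1 : -∑ i, fderiv ℝ u y (christoffel g y (f i) (f i)) ≤ n * C * T := by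
      rw [← Finset.sum_neg_distrib, hTdef, Finset.mul_sum]
      refine Finset.sum_le_sum fun i _ => ?_
      calc -fderiv ℝ u y (christoffel g y (f i) (f i))
          ≤ |fderiv ℝ u y (christoffel g y (f i) (f i))| := neg_le_abs _
        _ ≤ n * ‖christoffel g y (f i) (f i)‖ := (fderiv ℝ u y).le_opNorm _
        _ ≤ n * (C * ‖f i‖ * ‖f i‖) := by gcongr; exact hb3 _ _
        _ = n * C * ‖f i‖ ^ 2 := by ring
    have e2 : ∑ i, fderiv ℝ u y (f i) ^ 2 ≤ n * n * T := by
      rw [hTdef, Finset.mul_sum]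
      refine Finset.sum_le_sum fun i _ => ?_
      calc fderiv ℝ u y (f i) ^ 2 = |fderiv ℝ u y (f i)| ^ 2 := (sq_abs _).symm
        _ ≤ (n * ‖f i‖) ^ 2 := by gcongr; exact hDuf i
        _ = n * n * ‖f i‖ ^ 2 := by ring
    have e3 : ∑ i, fderiv ℝ k y (f i) * fderiv ℝ u y (f i) ≤ ‖fderiv ℝ k y‖ * n * T := by
      rw [hTdef, Finset.mul_sum]
      refine Finset.sum_le_sum fun i _ => ?_
      calc fderiv ℝ k y (f i) * fderiv ℝ u y (f i)
          ≤ |fderiv ℝ k y (f i)| * |fderiv ℝ u y (f i)| := (le_abs_self _).trans (abs_mul _ _).le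
        _ ≤ (‖fderiv ℝ k y‖ * ‖f i‖) * (n * ‖f i‖) := by
          gcongr
          · exact (fderiv ℝ k y).le_opNorm _
          · exact hDuf i
        _ = ‖fderiv ℝ k y‖ * n * ‖f i‖ ^ 2 := by ring
    have hineq' : 0 ≤ ∑ i, (fderiv ℝ (fderiv ℝ u) y (f i) (f i)
          - fderiv ℝ u y (christoffel g y (f i) (f i)))
        + a * ∑ i, fderiv ℝ u y (f i) ^ 2 + b * ∑ i, fderiv ℝ k y (f i) * fderiv ℝ u y (f i) :=
      hineq
    rw [Finset.sum_sub_distrib] at hineq'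
    -- `|∇τ|²` is absorbed into a term linear in `n`, as `n` is bounded near `x₀`
    have e4 : a * ∑ i, fderiv ℝ u y (f i) ^ 2 ≤ A * (‖fderiv ℝ u x₀‖ + 1) * n * T :=
      calc a * ∑ i, fderiv ℝ u y (f i) ^ 2 ≤ a * (n * n * T) := by gcongr
        _ ≤ A * ((‖fderiv ℝ u x₀‖ + 1) * n * T) := by
          have : 0 ≤ A := ha0.trans hAy.le
          gcongr
        _ = _ := by ring
    have e5 : b * ∑ i, fderiv ℝ k y (f i) * fderiv ℝ u y (f i) ≤ B * n * T :=
      calc b * ∑ i, fderiv ℝ k y (f i) * fderiv ℝ u y (f i)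
          ≤ b * (‖fderiv ℝ k y‖ * n * T) := by gcongr
        _ = (b * ‖fderiv ℝ k y‖) * n * T := by ring
        _ ≤ B * n * T := by gcongr
    have hcoef : 0 ≤ C + A * (‖fderiv ℝ u x₀‖ + 1) + B := by
      have h1 : 0 ≤ A := ha0.trans hAy.le
      have h2 : 0 ≤ B := (mul_nonneg hb0 (norm_nonneg _)).trans hBy.le
      positivity
    have e6 : (C + A * (‖fderiv ℝ u x₀‖ + 1) + B) * T * n
        ≤ (C + A * (‖fderiv ℝ u x₀‖ + 1) + B) * (m * lam⁻¹) * n := by gcongr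
    linarith
  have hcont := (continuousAt_extChartAt (I := 𝓡 m) q₀).eventually hloc
  filter_upwards [hcont, (isOpen_extChartAt_source (I := 𝓡 m) q₀).mem_nhds hq₀] with q hq hqs
  simpa only [hu, Function.comp_apply, (extChartAt (𝓡 m) q₀).left_inv hqs] using hq

end DoublyWarpedProduct

namespace DoublyWarpedProduct

variable {m : ℕ} {P : Type*} [TopologicalSpace P]
  [ChartedSpace (EuclideanSpace ℝ (Fin m)) P] [IsManifold (𝓡 m) ∞ P]
  {D : DoublyWarpedProduct m P}
  {M : Type*} [TopologicalSpace M] [ChartedSpace (EuclideanSpace ℝ (Fin m)) M]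
  [IsManifold (𝓡 m) ∞ M] {ψ : M → ℝ × P}

/-! ### Rigidity -/

/-- The time function of the hypersurface is constant: the set where it attains its maximum is
nonempty by compactness, closed, and open by the strong maximum principle. -/
lemma IsSpacelikeHypersurface.exists_time_eq [ConnectedSpace M] [CompactSpace M] (hm : 0 < m)
    (hψ : D.IsSpacelikeHypersurface ψ) (hρ : ∀ t ∈ D.I, 0 ≤ deriv D.ρ t)
    (hH : ∀ (q : M) (ν : TangentSpace (stModel m) (ψ q)), D.IsFutureUnitNormal ψ q ν →
      D.sliceMeanCurvature (ψ q) ≤ D.meanCurvature ψ q ν) :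
    ∃ t₀ ∈ D.I, ∀ q, (ψ q).1 = t₀ := by
  have hcont : Continuous fun q => (ψ q).1 := hψ.contMDiff_time.continuous
  obtain ⟨q₀, -, hq₀⟩ := isCompact_univ.exists_isMaxOn Set.univ_nonempty hcont.continuousOn
  have hmax : ∀ q, (ψ q).1 ≤ (ψ q₀).1 := fun q => hq₀ (Set.mem_univ q)
  refine ⟨(ψ q₀).1, hψ.mem_I q₀, fun q => ?_⟩
  have hclopen : IsClopen {q | (ψ q).1 = (ψ q₀).1} := by
    refine ⟨isClosed_eq hcont continuous_const, isOpen_iff_mem_nhds.2 fun q hq => ?_⟩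
    have hq' : (ψ q).1 = (ψ q₀).1 := hq
    have h := hψ.eventually_time_eq_of_isMax hm hρ hH (q₀ := q) fun q' => hq'.symm ▸ hmax q'
    rw [hq'] at h
    exact h
  have huniv := hclopen.eq_univ ⟨q₀, rfl⟩
  have hmem : q ∈ {q | (ψ q).1 = (ψ q₀).1} := huniv ▸ Set.mem_univ q
  exact hmem

/-- For a spacelike hypersurface contained in a slice, the projection to the fibre is a local
diffeomorphism, hence open: a tangent vector in the kernel of the projection is in the
kernel of the positive definite induced metric. -/
lemma IsSpacelikeHypersurface.range_snd_mem_nhds (hψ : D.IsSpacelikeHypersurface ψ) {t₀ : ℝ}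
    (ht₀ : ∀ q, (ψ q).1 = t₀) (q : M) : Set.range (fun q => (ψ q).2) ∈ 𝓝 (ψ q).2 := by
  have hM1 : IsManifold (𝓡 m) 1 M := IsManifold.of_le (n := ∞) (by simp)
  have hq := mem_extChartAt_source (I := 𝓡 m) q
  have hp := mem_extChartAt_source (I := stModel m) (ψ q)
  have hF := contDiffAt_writtenInCharts hψ.contMDiff hq hp
  have hg := (hψ.coordForm_inducedMetric_eventuallyEq hq hp).eq_of_nhds
  have hΦ := contDiffAt_writtenInCharts (contMDiff_snd.comp hψ.contMDiff) hq
    (mem_extChartAt_source (I := 𝓡 m) (ψ q).2)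
  have hfst : ∀ y, ((extChartAt (stModel m) (ψ q) ∘ ψ ∘ (extChartAt (𝓡 m) q).symm) y).1 = t₀ :=
    fun y => by simp only [Function.comp_apply, extChartAt_stModel_apply, ht₀]
  have hsnd : extChartAt (𝓡 m) (ψ q).2 ∘ (Prod.snd ∘ ψ) ∘ (extChartAt (𝓡 m) q).symm
      = fun y => ((extChartAt (stModel m) (ψ q) ∘ ψ ∘ (extChartAt (𝓡 m) q).symm) y).2 := by
    funext y
    simp only [Function.comp_apply, extChartAt_stModel_apply]
  have hΦx : (extChartAt (𝓡 m) (ψ q).2 ∘ (Prod.snd ∘ ψ) ∘ (extChartAt (𝓡 m) q).symm)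
      (extChartAt (𝓡 m) q q) = extChartAt (𝓡 m) (ψ q).2 (ψ q).2 := by
    simp only [Function.comp_apply, extChartAt_to_inv]
  set F := extChartAt (stModel m) (ψ q) ∘ ψ ∘ (extChartAt (𝓡 m) q).symm with hFdef
  set Φ := extChartAt (𝓡 m) (ψ q).2 ∘ (Prod.snd ∘ ψ) ∘ (extChartAt (𝓡 m) q).symm with hΦdef
  set x := extChartAt (𝓡 m) q q with hx
  have hFd : HasFDerivAt F (fderiv ℝ F x) x := (hF.differentiableAt (by simp)).hasFDerivAt
  have hDfst : ∀ v, (fderiv ℝ F x v).1 = 0 := fun v => by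
    have h1 : HasFDerivAt (fun y => (F y).1) (0 : EuclideanSpace ℝ (Fin m) →L[ℝ] ℝ) x := by
      simp only [hfst]
      exact hasFDerivAt_const _ _
    exact congrArg (fun L : EuclideanSpace ℝ (Fin m) →L[ℝ] ℝ => L v) (hFd.fst.unique h1)
  have hDsnd : ∀ v, fderiv ℝ Φ x v = (fderiv ℝ F x v).2 := fun v => by
    rw [hsnd, hFd.snd.fderiv]
    rfl
  have hsurj : Function.Surjective (fderiv ℝ Φ x) := by
    refine (LinearMap.injective_iff_surjective
      (f := (fderiv ℝ Φ x : EuclideanSpace ℝ (Fin m) →ₗ[ℝ] EuclideanSpace ℝ (Fin m)))).1 ?_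
    rw [injective_iff_map_eq_zero]
    intro v hv
    by_contra h
    have hv' : fderiv ℝ F x v = 0 :=
      Prod.ext (hDfst v) ((hDsnd v).symm.trans hv)
    have h1 := hψ.coordForm_pos (mem_extChartAt_target q) v h
    rw [hg, pullbackForm_apply, hv'] at h1
    simp at h1
  have hmap := (hΦ.hasStrictFDerivAt (by simp)).map_nhds_eq_of_surj
    (LinearMap.range_eq_top.2 hsurj)
  rw [hΦx] at hmap
  -- `Φ` maps neighbourhoods to neighbourhoods, and it is `π_P ∘ ψ` in charts
  have hrange : Φ '' (Set.univ ∩ {y | (ψ ((extChartAt (𝓡 m) q).symm y)).2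
      ∈ (extChartAt (𝓡 m) (ψ q).2).source}) ∈ 𝓝 (extChartAt (𝓡 m) (ψ q).2 (ψ q).2) := by
    rw [← hmap]
    refine image_mem_map (inter_mem univ_mem ?_)
    have hc : ContinuousAt (fun y => (ψ ((extChartAt (𝓡 m) q).symm y)).2) x :=
      (continuous_snd.comp hψ.contMDiff.continuous).continuousAt.comp
        (continuousAt_extChartAt_symm q)
    refine hc.eventually_mem ((isOpen_extChartAt_source _).mem_nhds ?_)
    rw [hx, extChartAt_to_inv]
    exact mem_extChartAt_source _
  have hpre := (continuousAt_extChartAt (I := 𝓡 m) (ψ q).2).preimage_mem_nhds hrange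
  filter_upwards [hpre, extChartAt_source_mem_nhds (I := 𝓡 m) (ψ q).2] with z hz hzs
  obtain ⟨y, ⟨-, hy⟩, hyz⟩ := hz
  exact ⟨(extChartAt (𝓡 m) q).symm y, (extChartAt (𝓡 m) (ψ q).2).injOn hy hzs hyz⟩

end DoublyWarpedProduct

theorem theorem3p2 {m : ℕ} (hm : 0 < m)
    {P : Type*} [TopologicalSpace P] [T2Space P] [SecondCountableTopology P] [ConnectedSpace P]
    [ChartedSpace (EuclideanSpace ℝ (Fin m)) P] [IsManifold (𝓡 m) ∞ P]
    (D : DoublyWarpedProduct m P) (hρ : ∀ t ∈ D.I, 0 ≤ deriv D.ρ t)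
    {M : Type*} [TopologicalSpace M] [T2Space M] [SecondCountableTopology M]
    [ConnectedSpace M] [CompactSpace M]
    [ChartedSpace (EuclideanSpace ℝ (Fin m)) M] [IsManifold (𝓡 m) ∞ M]
    (ψ : M → ℝ × P) (hψ : D.IsSpacelikeHypersurface ψ)
    (hH : ∀ (q : M) (ν : TangentSpace (stModel m) (ψ q)), D.IsFutureUnitNormal ψ q ν →
      D.sliceMeanCurvature (ψ q) ≤ D.meanCurvature ψ q ν) :
    ∃ t₀ ∈ D.I, Set.range ψ = {t₀} ×ˢ Set.univ := by
  obtain ⟨t₀, ht₀, htime⟩ := hψ.exists_time_eq hm hρ hH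
  refine ⟨t₀, ht₀, ?_⟩
  have hcont : Continuous fun q => (ψ q).2 := continuous_snd.comp hψ.contMDiff.continuous
  have hclopen : IsClopen (Set.range fun q => (ψ q).2) := by
    refine ⟨(isCompact_range hcont).isClosed, isOpen_iff_mem_nhds.2 ?_⟩
    rintro _ ⟨q, rfl⟩
    exact hψ.range_snd_mem_nhds htime q
  have huniv := hclopen.eq_univ (Set.range_nonempty _)
  ext ⟨t, z⟩
  simp only [Set.mem_range, Set.mem_prod, Set.mem_singleton_iff, Set.mem_univ, and_true]
  constructor
  · rintro ⟨q, hq⟩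
    rw [← htime q, hq]
  · rintro rfl
    obtain ⟨q, hq⟩ : z ∈ Set.range fun q => (ψ q).2 := huniv ▸ Set.mem_univ z
    exact ⟨q, Prod.ext (htime q) hq⟩
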